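/- Let $X$ be a compact Riemann surface (compact and connected), let $M$ be a connected complex manifold, and let $\{f_\lambda=\varphi_\lambda\circ f\circ\psi_\lambda^{-1}:W_\lambda\to X\}_{\lambda\in M}$ be a natural family of Ahlfors island maps. That is: $W\subset X$ is a non-empty open set, $f:W\to X$ is holomorphic, $\varphi_\lambda,\psi_\lambda:X\to X$ are quasiconformal homeomorphisms such that $\lambda\mapsto\varphi_\lambda(x)$ and $\lambda\mapsto\psi_\lambda(x)$ are holomorphic on $M$ for every $x\in X$, $W_\lambda=\psi_\lambda(W)$, and every $f_\lambda:W_\lambda\to X$ is an Ahlfors island map. Here a holomorphic map $g:V\to X$ on a non-empty open set $V\subset X$, non-constant on every connected component of $V$, is an Ahlfors island map if there is an $N\ge 1$ such that for any $N$ Jordan domains $D_1,\dots,D_N\subset X$ with pairwise disjoint closures and any open set $O\subset X$ meeting $\partial V$, there are $1\le i\le N$ and an open set $\Omega\Subset O\cap V$ such that $g:\Omega\to D_i$ is a conformal isomorphism. Let $\lambda_0\in M$ and let $z_0$ be a repelling periodic point of period $p\ge1$ of $f_{\lambda_0}$. Let $U\subset M$ be a simply connected open neighbourhood of $\lambda_0$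 and let $U\ni\lambda\mapsto z_0(\lambda)\in X$ be a holomorphic map with $z_0(\lambda_0)=z_0$ such that $z_0(\lambda)$ is a repelling periodic point of period $p$ of $f_\lambda$ for every $\lambda\in U$. Suppose that for all $\lambda_1\in U$ the map $f_{\lambda_1}$ has no non-persistent Misiurewicz relation of the form $f_{\lambda_1}^n(v(\lambda_1))=z_0(\lambda_1)$, that is: whenever $n\ge0$ and $v$ is a critical or asymptotic value of $f_{\lambda_1}$ with $f_{\lambda_1}^n(v)=z_0(\lambda_1)$, one has $f_\lambda^n(v(\lambda))=z_0(\lambda)$ for all $\lambda$ in a neighbourhood of $\lambda_1$, where $v(\lambda)=\varphi_\lambda(\varphi_{\lambda_1}^{-1}(v))$. (A point $v\in X$ is an asymptotic value of $f_{\lambda_1}$ if there is a curve $\gamma:[0,\infty)\to W_{\lambda_1}$ with $\gamma(t)\to\partial W_{\lambda_1}$ and $f_{\lambda_1}(\gamma(t))\to v$ as $t\to\infty$.) For a partially defined map $g$ and a point $w$ let $\mathcal O^-(w,g)=\bigcup_{n\ge0}g^{-n}(\{w\})$. Then there is a holomorphic motion of $A:=\mathcal O^-(z_0,f_{\lambda_0}^p)$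 over $U$ with basepoint $\lambda_0$, i.e. a map $H:U\times A\to X$, $(\lambda,z)\mapsto H_\lambda(z)$, such that $\lambda\mapsto H_\lambda(z)$ is holomorphic on $U$ for every $z\in A$, $H_\lambda$ is injective on $A$ for every $\lambda\in U$, and $H_{\lambda_0}=\mathrm{id}_A$; moreover, for every $\lambda\in U$, $H_\lambda(A)=\mathcal O^-(z_0(\lambda),f_\lambda^p)$, and the motion respects the dynamics of $f_\lambda^p$: $H_\lambda(f_{\lambda_0}^p(z))=f_\lambda^p(H_\lambda(z))$ whenever both $z$ and $f_{\lambda_0}^p(z)$ belong to $A$. -/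

import Mathlib

open Set Filter Topology MeasureTheory
open scoped Manifold ContDiff NNReal

namespace AhlforsIsland

noncomputable section

/-! ### Quasiconformal homeomorphisms -/

/-- The Wirtinger derivative `∂η/∂z` of a (real-differentiable) function `η : ℂ → ℂ`. -/
def wirtinger (η : ℂ → ℂ) (z : ℂ) : ℂ :=
  (fderiv ℝ η z 1 - Complex.I * fderiv ℝ η z Complex.I) / 2

/-- The Wirtinger derivative `∂η/∂z̄` of a (real-differentiable) function `η : ℂ → ℂ`. -/
def wirtingerBar (η : ℂ → ℂ) (z : ℂ) : ℂ :=
  (fderiv ℝ η z 1 + Complex.I * fderiv ℝ η z Complex.I) / 2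

/-- `g` has on the open set `Ω ⊆ ℂ` locally integrable distributional derivatives `g_z = P` and
`g_z̄ = Q` that satisfy `|g_z̄| ≤ k |g_z|` almost everywhere. -/
def HasDilatationBoundOn (k : ℝ) (g : ℂ → ℂ) (Ω : Set ℂ) : Prop :=
  ∃ P Q : ℂ → ℂ, LocallyIntegrableOn P Ω ∧ LocallyIntegrableOn Q Ω ∧
    (∀ η : ℂ → ℂ, ContDiff ℝ ∞ η → HasCompactSupport η → tsupport η ⊆ Ω →
      ∫ z, g z * wirtinger η z = - ∫ z, P z * η z) ∧
    (∀ η : ℂ → ℂ, ContDiff ℝ ∞ η → HasCompactSupport η → tsupport η ⊆ Ω →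
      ∫ z, g z * wirtingerBar η z = - ∫ z, Q z * η z) ∧
    ∀ᵐ z ∂(volume.restrict Ω), ‖Q z‖ ≤ k * ‖P z‖

/-- A (sense-preserving) quasiconformal homeomorphism of a Riemann surface, by the analytic
definition: for some `k < 1`, in all holomorphic charts it has locally integrable distributional
derivatives with `|∂̄φ| ≤ k |∂φ|` almost everywhere. -/
def IsQuasiconformal {X : Type*} [TopologicalSpace X] [ChartedSpace ℂ X] (φ : X ≃ₜ X) : Prop :=
  ∃ k : ℝ, 0 ≤ k ∧ k < 1 ∧ ∀ c ∈ atlas ℂ X, ∀ c' ∈ atlas ℂ X,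
    HasDilatationBoundOn k (fun z => c' (φ (c.symm z)))
      (c.target ∩ c.symm ⁻¹' (φ ⁻¹' c'.source))

/-! ### Partially defined maps

A partially defined map `W → X`, `W ⊆ X`, is given by a total function `f : X → X` and its domain
`W`; the values of `f` outside `W` play no role. -/

section PartialMaps

variable {X : Type*}

/-- The `n`-th iterate of the partial map `f : W → X` is defined at `x`, and its value is `y`. -/
def IterTo (f : X → X) (W : Set X) (n : ℕ) (x y : X) : Prop :=
  (∀ j < n, f^[j] x ∈ W) ∧ f^[n] x = y

/-- The backward orbit `⋃ₙ (f^p)⁻ⁿ({w})` of `w` under the `p`-th iterate of `f : W → X`. -/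
def backwardOrbit (f : X → X) (W : Set X) (p : ℕ) (w : X) : Set X :=
  {x | ∃ n : ℕ, IterTo f W (n * p) x w}

end PartialMaps

section Dynamics

variable {X : Type*} [TopologicalSpace X]

/-- A Jordan domain in a surface: the interior of a closed topological disc. -/
def IsJordanDomain (D : Set X) : Prop :=
  IsOpen D ∧ ∃ e : ℂ → X, ContinuousOn e (Metric.closedBall 0 1) ∧
    InjOn e (Metric.closedBall 0 1) ∧ e '' Metric.ball 0 1 = D

/-- `v` is an asymptotic value of `f : W → X`: there is a curve `γ` in `W` with `γ(t) → ∂W` and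
`f (γ t) → v` as `t → ∞`. The curve need not converge to a point of `∂W`. -/
def IsAsymptoticValue (f : X → X) (W : Set X) (v : X) : Prop :=
  ∃ γ : ℝ≥0 → X, Continuous γ ∧ (∀ t, γ t ∈ W) ∧
    Tendsto γ atTop (𝓝ˢ (frontier W)) ∧ Tendsto (fun t => f (γ t)) atTop (𝓝 v)

variable [ChartedSpace ℂ X]

/-- `f : W → X` has the `N`-island property. -/
def HasIslandProperty (f : X → X) (W : Set X) (N : ℕ) : Prop :=
  ∀ D : Fin N → Set X, (∀ i, IsJordanDomain (D i)) →
    Pairwise (fun i j => Disjoint (closure (D i)) (closure (D j))) →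
    ∀ U : Set X, IsOpen U → (U ∩ frontier W).Nonempty →
      ∃ i : Fin N, ∃ Ω : Set X, IsOpen Ω ∧ IsCompact (closure Ω) ∧ closure Ω ⊆ U ∩ W ∧
        MDifferentiableOn 𝓘(ℂ) 𝓘(ℂ) f Ω ∧ BijOn f Ω (D i)

/-- `f : W → X` is an Ahlfors island map: `W` is open and non-empty, `f` is holomorphic on `W` and
non-constant on every connected component of `W`, and it has the `N`-island property for some
`N ≥ 1`. -/
structure IsAhlforsIslandMap (f : X → X) (W : Set X) : Prop where
  isOpen : IsOpen W
  nonempty : W.Nonempty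
  holomorphic : MDifferentiableOn 𝓘(ℂ) 𝓘(ℂ) f W
  nonconstant : ∀ x ∈ W, ∃ y ∈ connectedComponentIn W x, f y ≠ f x
  island : ∃ N : ℕ, 1 ≤ N ∧ HasIslandProperty f W N

/-- `v` is a critical value of `f : W → X`. -/
def IsCriticalValue (f : X → X) (W : Set X) (v : X) : Prop :=
  ∃ c ∈ W, mfderiv 𝓘(ℂ) 𝓘(ℂ) f c = 0 ∧ f c = v

/-- The multiplier at `z` of a germ `g : (X, z) → (X, z)`, computed in a chart around `z`. -/
def multiplier (g : X → X) (z : X) : ℂ :=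
  deriv (fun u => chartAt ℂ z (g ((chartAt ℂ z).symm u))) (chartAt ℂ z z)

/-- `z` is a repelling periodic point of `f : W → X`, of period `p`. -/
def IsRepellingPeriodicPoint (f : X → X) (W : Set X) (p : ℕ) (z : X) : Prop :=
  1 ≤ p ∧ IterTo f W p z z ∧ 1 < ‖multiplier f^[p] z‖

end Dynamics

/-! ### Natural families -/

section Families

variable {M X : Type*} [TopologicalSpace X]

/-- The domain `W_t = ψ_t(W)` of the map `f_t` of a natural family. -/
def famDom (W : Set X) (ψ : M → X ≃ₜ X) (t : M) : Set X :=
  ψ t '' W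

/-- The map `f_t = φ_t ∘ f ∘ ψ_t⁻¹` of a natural family. -/
def famMap (f : X → X) (φ ψ : M → X ≃ₜ X) (t : M) : X → X :=
  fun x => φ t (f ((ψ t).symm x))

variable (E : Type*) [NormedAddCommGroup E] [NormedSpace ℂ E]
  [TopologicalSpace M] [ChartedSpace E M] [ChartedSpace ℂ X]

/-- `(φ_t)` is a family of quasiconformal homeomorphisms of `X` that depends holomorphically on
the parameter `t` in the complex manifold `M` (modelled on `E`). -/
def IsHolomorphicQCFamily (φ : M → X ≃ₜ X) : Prop :=
  (∀ t, IsQuasiconformal (φ t)) ∧ ∀ x, MDifferentiable 𝓘(ℂ, E) 𝓘(ℂ) (fun t => φ t x)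

/-- `f_t = φ_t ∘ f ∘ ψ_t⁻¹ : ψ_t(W) → X`, `t ∈ M`, is a natural family of holomorphic maps. -/
structure IsNaturalFamily (f : X → X) (W : Set X) (φ ψ : M → X ≃ₜ X) : Prop where
  isOpen : IsOpen W
  holomorphic_base : MDifferentiableOn 𝓘(ℂ) 𝓘(ℂ) f W
  left : IsHolomorphicQCFamily E φ
  right : IsHolomorphicQCFamily E ψ
  holomorphic : ∀ t, MDifferentiableOn 𝓘(ℂ) 𝓘(ℂ) (famMap f φ ψ t) (famDom W ψ t)

/-- For the parameter `s`, the map `f_s` of a natural family has a non-persistent Misiurewicz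
relation `f_s^n(v(s)) = ζ(s)`: here `v` is a critical or asymptotic value of `f_s`, it moves with
the parameter as `v(t) = φ_t(φ_s⁻¹(v))`, and it is false that `f_t^n(v(t)) = ζ(t)` for all `t` in a
neighbourhood of `s`. -/
def HasNonpersistentMisiurewicz (f : X → X) (W : Set X) (φ ψ : M → X ≃ₜ X) (ζ : M → X)
    (s : M) : Prop :=
  ∃ (n : ℕ) (v : X),
    (IsCriticalValue (famMap f φ ψ s) (famDom W ψ s) v ∨
      IsAsymptoticValue (famMap f φ ψ s) (famDom W ψ s) v) ∧
    IterTo (famMap f φ ψ s) (famDom W ψ s) n v (ζ s) ∧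
    ¬ ∀ᶠ t in 𝓝 s,
      IterTo (famMap f φ ψ t) (famDom W ψ t) n (φ t ((φ s).symm v)) (ζ t)

/-- `H` is a holomorphic motion of `A ⊆ X` over the open set `U ⊆ M` with basepoint `t₀`. -/
structure IsHolomorphicMotion (U : Set M) (t₀ : M) (A : Set X) (H : M → X → X) : Prop where
  holomorphic : ∀ x ∈ A, MDifferentiableOn 𝓘(ℂ, E) 𝓘(ℂ) (fun t => H t x) U
  injOn : ∀ t ∈ U, InjOn (H t) A
  base : ∀ x ∈ A, H t₀ x = x

end Families

end

end AhlforsIsland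

open AhlforsIsland

/-! A point `x` with `f_{t₀}^n(x) = ζ(t₀)` is followed over `U` by solving `f_t^n(y(t)) = ζ(t)` one
inverse step at a time. Given `y'` with `f_t^n(y'(t)) = ζ(t)`, put `u(t) = φ_t⁻¹(y'(t))`. Then
`f_t(y(t)) = y'(t)` means that `ψ_t⁻¹(y(t))` lifts `u` through the single map `f`, whose critical
and asymptotic values correspond under `φ_t` to those of `f_t`.

If `u` avoids all singular values of `f`, paths in its image lift: a partial lift that escapes would
exhibit an asymptotic value. Simple connectivity of `U` then gives a global lift by monodromy. If
`u` meets a singular value `e` at one parameter, the absence of non-persistent relations forces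
`y'(t) = φ_t(e)` nearby, hence on all of `U`; then `u` is constant and `y(t) = ψ_t(w)` for a fixed
`w` (`exists_holomorphic_preimage`).

Both cases use local uniqueness of continuous solutions (`eventually_eq_of_iterTo`), an induction on
`n` in which persistence also handles critical points. Together with connectedness of `U`,
uniqueness makes the motion injective, identifies its image at each parameter and makes it commute
with `f_t^p`.

Continuity of `u` needs joint continuity of `φ_t(x)` and of its inverse, although holomorphy is
given only for each fixed `x`. Orbits of points outside a small open set omit an open set
(`exists_omitted_open`, by Baire), and discs omitting enough open sets obey a uniform Schwarz lemma
(`exists_uniform_schwarz`), proved with a strictly subharmonic function having finitely many poles.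
The lift is thus continuous; its holomorphy follows by comparison with the holomorphic branch `t ↦
ψ_t(v)` through the same point (`mdifferentiableAt_of_implicit`). -/

namespace AhlforsIsland

/-! ### Log-subharmonic functions through holomorphic support functions -/

section LogSubharmonic

variable {X : Type*} [TopologicalSpace X] [ChartedSpace ℂ X]

/-- `P` is supported from below at `p` by the modulus of a holomorphic function. This is a pointwise
form of the subharmonicity of `log P`. -/
def LogSubAt (P : X → ℝ) (p : X) : Prop :=
  ∃ K : X → ℂ, (∀ᶠ q in 𝓝 p, MDifferentiableAt 𝓘(ℂ) 𝓘(ℂ) K q) ∧ ‖K p‖ = P p ∧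
    ∀ᶠ q in 𝓝 p, ‖K q‖ ≤ P q

theorem LogSubAt.of_eventuallyEq_norm {P : X → ℝ} {p : X} {K : X → ℂ}
    (hK : ∀ᶠ q in 𝓝 p, MDifferentiableAt 𝓘(ℂ) 𝓘(ℂ) K q) (h : ∀ᶠ q in 𝓝 p, P q = ‖K q‖) :
    LogSubAt P p :=
  ⟨K, hK, h.self_of_nhds.symm, h.mono fun _ hq => hq.ge⟩

theorem LogSubAt.mono {P Q : X → ℝ} {p : X} (hP : LogSubAt P p) (h : P p = Q p)
    (hPQ : ∀ᶠ q in 𝓝 p, P q ≤ Q q) : LogSubAt Q p := by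
  obtain ⟨K, h1, h2, h3⟩ := hP
  exact ⟨K, h1, h2.trans h, by filter_upwards [h3, hPQ] with q a b using a.trans b⟩

theorem LogSubAt.congr {P Q : X → ℝ} {p : X} (hP : LogSubAt P p)
    (hPQ : ∀ᶠ q in 𝓝 p, P q = Q q) : LogSubAt Q p :=
  hP.mono hPQ.self_of_nhds (hPQ.mono fun _ h => h.le)

theorem LogSubAt.of_eq_zero {P : X → ℝ} {p : X} (h : P p = 0) (h0 : ∀ᶠ q in 𝓝 p, 0 ≤ P q) :
    LogSubAt P p :=
  ⟨fun _ => 0, Eventually.of_forall fun _ => mdifferentiableAt_const, by simp [h], by simpa using h0⟩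

theorem LogSubAt.const {a : ℝ} (ha : 0 ≤ a) (p : X) : LogSubAt (fun _ : X => a) p :=
  ⟨fun _ => a, Eventually.of_forall fun _ => mdifferentiableAt_const, by simp [abs_of_nonneg ha],
    by simp [abs_of_nonneg ha]⟩

theorem LogSubAt.mul {P Q : X → ℝ} {p : X} (hP : LogSubAt P p) (hQ : LogSubAt Q p) :
    LogSubAt (fun q => P q * Q q) p := by
  obtain ⟨K, h1, h2, h3⟩ := hP
  obtain ⟨L, k1, k2, k3⟩ := hQ
  refine ⟨fun q => K q * L q, ?_, by rw [norm_mul, h2, k2], ?_⟩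
  · filter_upwards [h1, k1] with q a b using a.mul b
  · filter_upwards [h3, k3] with q a b
    rw [norm_mul]
    exact mul_le_mul a b (norm_nonneg _) ((norm_nonneg _).trans a)

theorem LogSubAt.pow {P : X → ℝ} {p : X} (hP : LogSubAt P p) (n : ℕ) :
    LogSubAt (fun q => P q ^ n) p := by
  induction n with
  | zero => simpa using LogSubAt.const zero_le_one p
  | succ n ih => simpa only [pow_succ] using ih.mul hP

theorem LogSubAt.prod {ι : Type*} (s : Finset ι) {P : ι → X → ℝ} {p : X}
    (h : ∀ i ∈ s, LogSubAt (P i) p) : LogSubAt (fun q => ∏ i ∈ s, P i q) p := by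
  classical
  induction s using Finset.induction_on with
  | empty => simpa using LogSubAt.const zero_le_one p
  | insert i s hi ih =>
    simp only [Finset.prod_insert hi]
    exact (h i (by simp)).mul (ih fun j hj => h j (by simp [hj]))

theorem LogSubAt.comp {P : X → ℝ} {u : ℂ → X} {t : ℂ}
    (hP : LogSubAt P (u t)) (hu : ∀ᶠ s in 𝓝 t, MDifferentiableAt 𝓘(ℂ) 𝓘(ℂ) u s) :
    LogSubAt (fun s => P (u s)) t := by
  obtain ⟨K, h1, h2, h3⟩ := hP
  have hc : ContinuousAt u t := hu.self_of_nhds.continuousAt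
  refine ⟨fun s => K (u s), ?_, h2, hc.eventually h3⟩
  filter_upwards [hu, hc.eventually h1] with s a b using b.comp s a

theorem LogSubAt.norm {c : X → ℂ} {p : X} (hc : ∀ᶠ q in 𝓝 p, MDifferentiableAt 𝓘(ℂ) 𝓘(ℂ) c q) :
    LogSubAt (fun q => ‖c q‖) p :=
  .of_eventuallyEq_norm hc (Eventually.of_forall fun _ => rfl)

theorem mdifferentiableAt_comp_differentiable {c : X → ℂ} {p : X} (g : ℂ → ℂ)
    (hg : DifferentiableAt ℂ g (c p)) (hc : MDifferentiableAt 𝓘(ℂ) 𝓘(ℂ) c p) :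
    MDifferentiableAt 𝓘(ℂ) 𝓘(ℂ) (fun q => g (c q)) p :=
  (mdifferentiableAt_iff_differentiableAt.2 hg).comp p hc

/-- Expanding `‖c q - c p‖² ≥ 0` bounds `‖c q‖²` below by the real part of an affine function of `c
q`, with equality at `p`; its exponential is the support function. -/
theorem LogSubAt.exp_normSq {c : X → ℂ} {p : X} {β : ℝ} (hβ : 0 ≤ β)
    (hc : ∀ᶠ q in 𝓝 p, MDifferentiableAt 𝓘(ℂ) 𝓘(ℂ) c q) :
    LogSubAt (fun q => Real.exp (β * ‖c q‖ ^ 2)) p := by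
  refine ⟨fun q => (fun z : ℂ => Complex.exp (β * (2 * (starRingEnd ℂ (c p) * z) - (‖c p‖ : ℂ) ^ 2)))
    (c q), ?_, ?_, Eventually.of_forall fun q => ?_⟩
  · filter_upwards [hc] with q hq
    exact mdifferentiableAt_comp_differentiable (fun z : ℂ =>
      Complex.exp (β * (2 * (starRingEnd ℂ (c p) * z) - (‖c p‖ : ℂ) ^ 2))) (by fun_prop) hq
  · simp only [Complex.norm_exp]
    congr 1
    rw [← Complex.normSq_eq_conj_mul_self, Complex.normSq_eq_norm_sq]
    norm_cast
    ring
  · simp only [Complex.norm_exp]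
    apply Real.exp_le_exp.2
    rw [Complex.re_ofReal_mul]
    apply mul_le_mul_of_nonneg_left _ hβ
    have h1 := Complex.normSq_nonneg (c q - c p)
    rw [Complex.normSq_apply] at h1
    have h2 : ‖c q‖ ^ 2 = (c q).re * (c q).re + (c q).im * (c q).im := by
      rw [← Complex.normSq_eq_norm_sq, Complex.normSq_apply]
    have h3 : ‖c p‖ ^ 2 = (c p).re * (c p).re + (c p).im * (c p).im := by
      rw [← Complex.normSq_eq_norm_sq, Complex.normSq_apply]
    have h4 : ((‖c p‖ : ℂ) ^ 2).re = ‖c p‖ ^ 2 := by norm_cast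
    simp only [Complex.sub_re, h4, Complex.mul_re, Complex.re_ofNat, Complex.im_ofNat,
      Complex.conj_re, Complex.conj_im, Complex.sub_im] at *
    nlinarith

/-- `P` is strictly subharmonic near `a`, on the logarithmic scale. -/
def StrictLogSubAt (P : X → ℝ) (a : X) : Prop :=
  ∃ c ∈ atlas ℂ X, a ∈ c.source ∧ ∃ ε : ℝ, 0 < ε ∧
    ∀ᶠ q in 𝓝 a, LogSubAt (fun w => P w * Real.exp (-ε * ‖c w‖ ^ 2)) q

/-- Maximum principle. Among the maximum points choose one of largest modulus. The modulus of its
support function has a local maximum there, so it is locally constant and the maximum is also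
attained at nearby points farther from the centre, a contradiction. -/
theorem le_of_logSubAt_of_le_on_sphere {L : ℂ → ℝ} {ρ B : ℝ}
    (hc : ContinuousOn L (Metric.closedBall 0 ρ)) (hL : ∀ t ∈ Metric.ball (0 : ℂ) ρ, LogSubAt L t)
    (hB : ∀ t ∈ Metric.sphere (0 : ℂ) ρ, L t ≤ B) : ∀ t ∈ Metric.closedBall (0 : ℂ) ρ, L t ≤ B := by
  intro t ht
  by_contra hlt
  push Not at hlt
  have hK := isCompact_closedBall (0 : ℂ) ρ
  obtain ⟨t₁, ht₁, hmax⟩ := hK.exists_isMaxOn ⟨t, ht⟩ hc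
  have hcl : IsClosed (Metric.closedBall (0 : ℂ) ρ ∩ L ⁻¹' {L t₁}) :=
    hc.preimage_isClosed_of_isClosed Metric.isClosed_closedBall isClosed_singleton
  have hScomp : IsCompact (Metric.closedBall (0 : ℂ) ρ ∩ L ⁻¹' {L t₁}) :=
    hK.of_isClosed_subset hcl inter_subset_left
  obtain ⟨t₂, ⟨ht₂, hLt₂⟩, hfar⟩ := hScomp.exists_isMaxOn ⟨t₁, ht₁, rfl⟩ continuous_norm.continuousOn
  simp only [mem_preimage, mem_singleton_iff] at hLt₂
  have hgt : B < L t₂ := by rw [hLt₂]; exact hlt.trans_le (hmax ht)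
  have hin : t₂ ∈ Metric.ball (0 : ℂ) ρ := by
    rcases (mem_closedBall_zero_iff.1 ht₂).lt_or_eq with h | h
    · exact mem_ball_zero_iff.2 h
    · exact absurd (hB t₂ (by simpa using h)) (not_le.2 hgt)
  obtain ⟨K, h1, h2, h3⟩ := hL t₂ hin
  have hnear : ∀ᶠ q in 𝓝 t₂, q ∈ Metric.ball (0 : ℂ) ρ := Metric.isOpen_ball.mem_nhds hin
  have hle : ∀ᶠ q in 𝓝 t₂, L q ≤ L t₂ := by
    filter_upwards [hnear] with q hq
    rw [hLt₂]; exact hmax (Metric.ball_subset_closedBall hq)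
  have hloc : IsLocalMax (Norm.norm ∘ K) t₂ := by
    filter_upwards [h3, hle] with q a b
    simpa [h2] using a.trans b
  have hconst := Complex.norm_eventually_eq_of_isLocalMax
    (h1.mono fun q hq => mdifferentiableAt_iff_differentiableAt.1 hq) hloc
  have hfin : ∀ᶠ q in 𝓝 t₂, ‖q‖ ≤ ‖t₂‖ := by
    filter_upwards [hconst, h3, hle, hnear] with q a b d e
    refine hfar ⟨Metric.ball_subset_closedBall e, ?_⟩
    rw [a, h2] at b
    exact (le_antisymm d b).trans hLt₂
  obtain ⟨r, hr, hr'⟩ := Metric.eventually_nhds_iff.1 hfin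
  rcases eq_or_ne t₂ 0 with h0 | h0
  · have := @hr' ((r / 2 : ℝ) : ℂ) (by simp [h0, abs_of_pos hr]; linarith)
    simp [h0] at this
    linarith [abs_of_pos hr]
  · have hn : 0 < ‖t₂‖ := norm_pos_iff.2 h0
    have := @hr' (t₂ + ((r / 2 / ‖t₂‖ : ℝ) : ℂ) * t₂) (by
      rw [dist_eq_norm, add_sub_cancel_left, norm_mul, Complex.norm_real, Real.norm_eq_abs,
        abs_of_pos (by positivity)]
      field_simp
      linarith)
    rw [show t₂ + ((r / 2 / ‖t₂‖ : ℝ) : ℂ) * t₂ = ((1 + r / 2 / ‖t₂‖ : ℝ) : ℂ) * t₂ by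
      push_cast; ring, norm_mul, Complex.norm_real, Real.norm_eq_abs,
      abs_of_pos (by positivity)] at this
    have h5 : 0 < r / 2 / ‖t₂‖ * ‖t₂‖ := by positivity
    linarith

end LogSubharmonic

/-! ### A strictly subharmonic potential with finitely many logarithmic poles -/

section Potential

set_option linter.unusedSectionVars false

variable {X : Type*} [TopologicalSpace X] [ChartedSpace ℂ X]

open Classical in
/-- A function `h` of the distance to `c y` in a chart `c`, extended by `1`. -/
noncomputable def radialExt (h : ℝ → ℝ) (c : OpenPartialHomeomorph X ℂ) (y : X) (q : X) : ℝ :=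
  if q ∈ c.source then h ‖c q - c y‖ else 1

theorem radialExt_of_mem {h : ℝ → ℝ} {c : OpenPartialHomeomorph X ℂ} {y q : X}
    (hq : q ∈ c.source) : radialExt h c y q = h ‖c q - c y‖ := if_pos hq

theorem radialExt_eq_one [T2Space X] {h : ℝ → ℝ} {c : OpenPartialHomeomorph X ℂ} {y : X} {R : ℝ}
    (hR : Metric.closedBall (c y) R ⊆ c.target) (h1 : ∀ r, R ≤ r → h r = 1) {q : X}
    (hq : q ∈ c.source → R < ‖c q - c y‖) : ∀ᶠ w in 𝓝 q, radialExt h c y w = 1 := by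
  have hK : IsClosed (c.symm '' Metric.closedBall (c y) R) :=
    ((isCompact_closedBall _ _).image_of_continuousOn (c.continuousOn_symm.mono hR)).isClosed
  have : q ∉ c.symm '' Metric.closedBall (c y) R := by
    rintro ⟨z, hz, rfl⟩
    have := hq (c.map_target (hR hz))
    rw [c.right_inv (hR hz), ← dist_eq_norm] at this
    exact absurd hz (not_le.2 this)
  filter_upwards [hK.isOpen_compl.mem_nhds this] with w hw
  by_cases hws : w ∈ c.source
  · rw [radialExt_of_mem hws]
    apply h1
    by_contra hlt
    exact hw ⟨c w, by simpa [dist_eq_norm] using (not_le.1 hlt).le, c.left_inv hws⟩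
  · exact if_neg hws

theorem continuousAt_radialExt [T2Space X] {h : ℝ → ℝ} {c : OpenPartialHomeomorph X ℂ} {y : X} {R : ℝ}
    (hR : Metric.closedBall (c y) R ⊆ c.target) (h1 : ∀ r, R ≤ r → h r = 1) {q : X}
    (hc : q ∈ c.source → ContinuousAt h ‖c q - c y‖) : ContinuousAt (radialExt h c y) q := by
  by_cases hq : q ∈ c.source
  · have : ContinuousAt (fun w => h ‖c w - c y‖) q :=
      ContinuousAt.comp (f := fun w => ‖c w - c y‖) (hc hq)
        ((c.continuousAt hq).sub continuousAt_const).norm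
    refine this.congr ?_
    filter_upwards [c.open_source.mem_nhds hq] with w hw using (radialExt_of_mem hw).symm
  · exact continuousAt_const.congr
      ((radialExt_eq_one hR h1 (q := q) fun h => absurd h hq).mono fun _ h => h.symm)

theorem eventually_mdifferentiableAt_chart [IsManifold 𝓘(ℂ) 1 X] {c : OpenPartialHomeomorph X ℂ}
    (hc : c ∈ atlas ℂ X) {q : X} (hq : q ∈ c.source) :
    ∀ᶠ w in 𝓝 q, MDifferentiableAt 𝓘(ℂ) 𝓘(ℂ) c w := by
  filter_upwards [c.open_source.mem_nhds hq] with w hw using mdifferentiableAt_atlas hc hw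

/-- The radial profile `(R / r) exp ((r² - R²) / (2 R²))`, constant for `r ≥ R`. -/
noncomputable def poleProfile (R r : ℝ) : ℝ :=
  R / min r R * Real.exp ((min r R ^ 2 - R ^ 2) / (2 * R ^ 2))

theorem poleProfile_of_ge {R : ℝ} (hR : 0 < R) (r : ℝ) (hr : R ≤ r) : poleProfile R r = 1 := by
  simp [poleProfile, min_eq_right hr, hR.ne']

/-- The inequality `log s ≤ s - 1` at `s = (m / R)²`. The value 1 is the minimum, attained from `r =
R` on, so the constant 1 supports the glued function along the seam. -/
theorem one_le_poleProfile {R r : ℝ} (hR : 0 < R) (hr : 0 < r) : 1 ≤ poleProfile R r := by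
  unfold poleProfile
  set m := min r R with hm
  have hm0 : 0 < m := lt_min hr hR
  have hmR : m ≤ R := min_le_right _ _
  have h1 : Real.log (m / R) ≤ (m / R) - 1 := Real.log_le_sub_one_of_pos (by positivity)
  have h2 : Real.log (m ^ 2 / R ^ 2) ≤ m ^ 2 / R ^ 2 - 1 :=
    Real.log_le_sub_one_of_pos (by positivity)
  rw [← div_pow, Real.log_pow] at h2
  have h3 : R / m = Real.exp (-Real.log (m / R)) := by
    rw [Real.exp_neg, Real.exp_log (by positivity), inv_div]
  rw [h3, ← Real.exp_add]
  apply Real.one_le_exp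
  have h4 : (m ^ 2 - R ^ 2) / (2 * R ^ 2) = ((m / R) ^ 2 - 1) / 2 := by field_simp
  rw [h4]
  push_cast at h2
  linarith [h2]

theorem continuousAt_poleProfile {R r : ℝ} (hR : 0 < R) (hr : 0 < r) :
    ContinuousAt (poleProfile R) r := by
  have : min r R ≠ 0 := (lt_min hr hR).ne'
  unfold poleProfile
  fun_prop (disch := assumption)

variable [T2Space X] [IsManifold 𝓘(ℂ) 1 X]

section Pole

variable {c : OpenPartialHomeomorph X ℂ} {y : X} {R : ℝ}

theorem norm_chart_sub_pos {q : X} (hy : y ∈ c.source) (hq : q ∈ c.source) (h : q ≠ y) :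
    0 < ‖c q - c y‖ :=
  norm_pos_iff.2 (sub_ne_zero.2 fun e => h (c.injOn hq hy e))

theorem one_le_radialExt_pole (hR : 0 < R) (hy : y ∈ c.source) {q : X} (hq : q ≠ y) :
    1 ≤ radialExt (poleProfile R) c y q := by
  by_cases hqs : q ∈ c.source
  · rw [radialExt_of_mem hqs]
    exact one_le_poleProfile hR (norm_chart_sub_pos hy hqs hq)
  · exact (if_neg hqs).ge

theorem continuousAt_radialExt_pole (hR : 0 < R) (hRt : Metric.closedBall (c y) R ⊆ c.target)
    (hy : y ∈ c.source) {q : X} (hq : q ≠ y) :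
    ContinuousAt (radialExt (poleProfile R) c y) q :=
  continuousAt_radialExt hRt (poleProfile_of_ge hR) fun hqs =>
    continuousAt_poleProfile hR (norm_chart_sub_pos hy hqs hq)

/-- Inside the disc the logarithm is harmonic plus `‖c - c y‖² / (2R²)`. Removing `‖c‖² / (2R²)`
leaves only harmonic terms, so the product is exactly the modulus of the holomorphic function `g ∘
c`. -/
theorem logSubAt_radialExt_pole_mul_exp (hc : c ∈ atlas ℂ X) (hy : y ∈ c.source)
    {q : X} (hqs : q ∈ c.source) (hq : q ≠ y) (hqR : ‖c q - c y‖ < R) :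
    LogSubAt (fun w => radialExt (poleProfile R) c y w *
      Real.exp (-(1 / (2 * R ^ 2)) * ‖c w‖ ^ 2)) q := by
  have hR : 0 < R := (norm_nonneg _).trans_lt hqR
  let g : ℂ → ℂ := fun z => R / (z - c y) *
    Complex.exp (1 / (2 * R ^ 2) * ((‖c y‖ : ℂ) ^ 2 - R ^ 2 - 2 * (starRingEnd ℂ (c y) * z)))
  have hne : ∀ᶠ w in 𝓝 q, w ∈ c.source ∧ w ≠ y ∧ ‖c w - c y‖ < R := by
    have h3 : ContinuousAt (fun w => ‖c w - c y‖) q :=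
      ((c.continuousAt hqs).sub continuousAt_const).norm
    filter_upwards [c.open_source.mem_nhds hqs, isOpen_ne.mem_nhds hq,
      h3.eventually (gt_mem_nhds hqR)] with w a b d using ⟨a, b, d⟩
  refine .of_eventuallyEq_norm (K := fun w => g (c w)) ?_ ?_
  · filter_upwards [hne] with w hw
    have h0 : c w - c y ≠ 0 := norm_pos_iff.1 (norm_chart_sub_pos hy hw.1 hw.2.1)
    refine mdifferentiableAt_comp_differentiable g ?_ (mdifferentiableAt_atlas hc hw.1)
    fun_prop (disch := assumption)
  · filter_upwards [hne] with w hw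
    rw [radialExt_of_mem hw.1, poleProfile, min_eq_left hw.2.2.le]
    simp only [g, norm_mul, norm_div, Complex.norm_real, Real.norm_eq_abs, abs_of_pos hR,
      Complex.norm_exp]
    rw [mul_assoc, ← Real.exp_add]
    congr 2
    have h5 : ((1 : ℂ) / (2 * R ^ 2)) = ((1 / (2 * R ^ 2) : ℝ) : ℂ) := by push_cast; ring
    rw [h5, Complex.re_ofReal_mul]
    have h1 : ‖c w - c y‖ ^ 2 = (c w - c y).re * (c w - c y).re + (c w - c y).im * (c w - c y).im := by
      rw [← Complex.normSq_eq_norm_sq, Complex.normSq_apply]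
    have h2 : ‖c w‖ ^ 2 = (c w).re * (c w).re + (c w).im * (c w).im := by
      rw [← Complex.normSq_eq_norm_sq, Complex.normSq_apply]
    have h3 : ‖c y‖ ^ 2 = (c y).re * (c y).re + (c y).im * (c y).im := by
      rw [← Complex.normSq_eq_norm_sq, Complex.normSq_apply]
    have h4 : ((‖c y‖ : ℂ) ^ 2).re = ‖c y‖ ^ 2 := by norm_cast
    have h6 : ((R : ℂ) ^ 2).re = R ^ 2 := by norm_cast
    simp only [Complex.sub_re, h4, h6, Complex.mul_re, Complex.re_ofNat, Complex.im_ofNat,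
      Complex.conj_re, Complex.conj_im, Complex.sub_im] at *
    rw [h1, h2, h3]
    field_simp
    ring

theorem logSubAt_radialExt_pole (hc : c ∈ atlas ℂ X) (hR : 0 < R)
    (hy : y ∈ c.source) {q : X} (hq : q ≠ y) : LogSubAt (radialExt (poleProfile R) c y) q := by
  have hge : ∀ᶠ w in 𝓝 q, 1 ≤ radialExt (poleProfile R) c y w := by
    filter_upwards [isOpen_ne.mem_nhds hq] with w hw using one_le_radialExt_pole hR hy hw
  by_cases hqs : q ∈ c.source
  · rcases lt_or_ge ‖c q - c y‖ R with h | h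
    · have := (logSubAt_radialExt_pole_mul_exp hc hy hqs hq h).mul
        (LogSubAt.exp_normSq (β := 1 / (2 * R ^ 2)) (by positivity)
          (eventually_mdifferentiableAt_chart hc hqs))
      refine this.congr (Eventually.of_forall fun w => ?_)
      rw [mul_assoc, ← Real.exp_add]
      simp
    · refine (LogSubAt.const zero_le_one q).mono ?_ hge
      rw [radialExt_of_mem hqs, poleProfile_of_ge hR _ h]
  · exact (LogSubAt.const zero_le_one q).mono (if_neg hqs).symm hge

end Pole

/-- A compact Riemann surface has a function that is finite, continuous and strictly subharmonic
off finitely many points, and these can be taken in any dense set. -/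
theorem exists_strictLogSub_potential [CompactSpace X] {D : Set X} (hD : Dense D) :
    ∃ (S : Finset X) (P : X → ℝ), ↑S ⊆ D ∧ ∀ q ∉ S, ContinuousAt P q ∧ 1 ≤ P q ∧ LogSubAt P q ∧
      StrictLogSubAt P q := by
  classical
  -- The disc is centred at a nearby point `y` of `D` rather than at `x`: with `y` within `R / 3`,
  -- the disc of radius `R / 2` still contains `x` and stays in the chart.
  have key : ∀ x : X, ∃ y ∈ D, y ∈ (chartAt ℂ x).source ∧ ∃ R : ℝ, 0 < R ∧
      Metric.closedBall (chartAt ℂ x y) R ⊆ (chartAt ℂ x).target ∧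
      ‖chartAt ℂ x x - chartAt ℂ x y‖ < R := by
    intro x
    set c := chartAt ℂ x with hcdef
    have hx : x ∈ c.source := mem_chart_source ℂ x
    obtain ⟨R, hR, hRt⟩ := Metric.isOpen_iff.1 c.open_target (c x) (c.map_source hx)
    have hV : IsOpen (c.source ∩ c ⁻¹' Metric.ball (c x) (R / 3)) :=
      c.continuousOn.isOpen_inter_preimage c.open_source Metric.isOpen_ball
    obtain ⟨y, ⟨hys, hyb⟩, hyD⟩ := hD.inter_open_nonempty _ hV
      ⟨x, hx, Metric.mem_ball_self (by positivity)⟩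
    have hyb' : dist (c y) (c x) < R / 3 := hyb
    refine ⟨y, hyD, hys, R / 2, by positivity, ?_, ?_⟩
    · refine (Metric.closedBall_subset_ball' ?_).trans hRt
      linarith
    · rw [← dist_eq_norm, dist_comm]; linarith
  choose y hyD hys R hR hRt hxR using key
  let c : X → OpenPartialHomeomorph X ℂ := fun x => chartAt ℂ x
  have hcov : ∀ x : X, (c x).source ∩ c x ⁻¹' Metric.ball (c x (y x)) (R x) ∈ 𝓝 x := fun x =>
    ((c x).continuousOn.isOpen_inter_preimage (c x).open_source Metric.isOpen_ball).mem_nhds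
      ⟨mem_chart_source ℂ x, by simpa [dist_eq_norm] using hxR x⟩
  obtain ⟨T, -, hT⟩ := isCompact_univ.elim_nhds_subcover _ fun x _ => hcov x
  -- The value at a pole is meaningless: division by zero makes the factor 0 there. All assertions
  -- are therefore made off `S`.
  refine ⟨T.image y, fun q => ∏ i ∈ T, radialExt (poleProfile (R i)) (c i) (y i) q, ?_, ?_⟩
  · intro q hq
    obtain ⟨i, -, rfl⟩ := Finset.mem_image.1 (Finset.mem_coe.1 hq)
    exact hyD i
  intro q hq
  have hne : ∀ i ∈ T, q ≠ y i := fun i hi e => hq (Finset.mem_image.2 ⟨i, hi, e.symm⟩)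
  have hat : ∀ i, c i ∈ atlas ℂ X := fun i => chart_mem_atlas ℂ i
  refine ⟨?_, ?_, ?_, ?_⟩
  · exact tendsto_finsetProd _ fun i hi =>
      continuousAt_radialExt_pole (hR i) (hRt i) (hys i) (hne i hi)
  · exact Finset.prod_induction _ (1 ≤ ·) (fun a b => one_le_mul_of_one_le_of_one_le) le_rfl
      fun i hi => one_le_radialExt_pole (hR i) (hys i) (hne i hi)
  · exact LogSubAt.prod T fun i hi => logSubAt_radialExt_pole (hat i) (hR i) (hys i) (hne i hi)
  · obtain ⟨i, hi, hqi⟩ := mem_iUnion₂.1 (hT (mem_univ q))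
    refine ⟨c i, hat i, hqi.1, 1 / (2 * R i ^ 2), by have := hR i; positivity, ?_⟩
    -- One factor whose disc contains `q` gives strictness; the remaining factors are
    -- log-subharmonic and do not destroy it.
    have hnear : ∀ᶠ w in 𝓝 q, (w ∈ (c i).source ∩ c i ⁻¹' Metric.ball (c i (y i)) (R i)) ∧
        ∀ j ∈ T, w ≠ y j := by
      refine Eventually.and (((c i).continuousOn.isOpen_inter_preimage (c i).open_source
        Metric.isOpen_ball).mem_nhds hqi) ?_
      exact (Finset.eventually_all T).2 fun j hj => isOpen_ne.mem_nhds (hne j hj)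
    filter_upwards [hnear] with w hw
    have h1 := logSubAt_radialExt_pole_mul_exp (R := R i) (hat i) (hys i) hw.1.1 (hw.2 i hi)
      (by simpa [dist_eq_norm] using hw.1.2)
    have h2 := LogSubAt.prod (T.erase i) (P := fun j => radialExt (poleProfile (R j)) (c j) (y j))
      (p := w) fun j hj => logSubAt_radialExt_pole (hat j) (hR j) (hys j)
        (hw.2 j (Finset.mem_of_mem_erase hj))
    refine (h1.mul h2).congr (Eventually.of_forall fun v => ?_)
    rw [← Finset.mul_prod_erase T _ hi]
    ring

end Potential

/-! ### A Schwarz lemma for discs that avoid the poles -/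

section Schwarz

set_option linter.unusedSectionVars false

variable {X : Type*} [TopologicalSpace X] [ChartedSpace ℂ X]

/-- The radial profile `(r / R) exp ((R² - r²) / R²)`, constant for `r ≥ R`. -/
noncomputable def zeroProfile (R r : ℝ) : ℝ :=
  min r R / R * Real.exp ((R ^ 2 - min r R ^ 2) / R ^ 2)

theorem zeroProfile_of_ge {R : ℝ} (hR : 0 < R) (r : ℝ) (hr : R ≤ r) : zeroProfile R r = 1 := by
  simp [zeroProfile, min_eq_right hr, hR.ne']

theorem continuous_zeroProfile (R : ℝ) : Continuous (zeroProfile R) := by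
  unfold zeroProfile
  fun_prop

theorem zeroProfile_nonneg {R r : ℝ} (hR : 0 < R) (hr : 0 ≤ r) : 0 ≤ zeroProfile R r := by
  unfold zeroProfile
  have : 0 ≤ min r R := le_min hr hR.le
  positivity

theorem zeroProfile_le {R r : ℝ} (hR : 0 < R) (hr : 0 ≤ r) : zeroProfile R r ≤ r / R * Real.exp 1 := by
  unfold zeroProfile
  have h0 : 0 ≤ min r R := le_min hr hR.le
  gcongr
  · exact min_le_left _ _
  · rw [div_le_one (by positivity)]
    nlinarith

theorem zeroProfile_le_exp {R r : ℝ} (hR : 0 < R) (hr : 0 ≤ r) : zeroProfile R r ≤ Real.exp 1 := by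
  rcases le_or_gt R r with h | h
  · rw [zeroProfile_of_ge hR r h]
    exact Real.one_le_exp zero_le_one
  · refine (zeroProfile_le hR hr).trans ?_
    have : r / R ≤ 1 := (div_le_one hR).2 h.le
    nlinarith [Real.exp_pos 1]

/-- With `s = r / R`, the logarithm `log s + 1 - s²` is nonnegative for `1/2 ≤ s² ≤ 1`. Hence the
glued profile is at least 1 on both sides of the seam, where the constant 1 supports it. -/
theorem one_le_zeroProfile {R r : ℝ} (hR : 0 < R) (hr : R ^ 2 / 2 ≤ r ^ 2) (hr0 : 0 < r) :
    1 ≤ zeroProfile R r := by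
  rcases le_or_gt R r with h | h
  · exact (zeroProfile_of_ge hR r h).ge
  unfold zeroProfile
  rw [min_eq_left h.le]
  have h1 : Real.log ((R / r) ^ 2) ≤ (R / r) ^ 2 - 1 := Real.log_le_sub_one_of_pos (by positivity)
  rw [Real.log_pow] at h1
  have h3 : r / R = Real.exp (-Real.log (R / r)) := by
    rw [Real.exp_neg, Real.exp_log (by positivity), inv_div]
  rw [h3, ← Real.exp_add]
  apply Real.one_le_exp
  push_cast at h1
  have h4 : ((R / r) ^ 2 - 1) / 2 ≤ (R ^ 2 - r ^ 2) / R ^ 2 := by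
    rw [div_pow, div_sub_one (by positivity), div_div, div_le_div_iff₀ (by positivity) (by positivity)]
    have : 0 ≤ R ^ 2 - r ^ 2 := by nlinarith
    nlinarith
  linarith

variable [T2Space X] [IsManifold 𝓘(ℂ) 1 X]

section

variable {c : OpenPartialHomeomorph X ℂ} {a : X} {R : ℝ}

theorem radialExt_zero_nonneg (hR : 0 < R) (q : X) : 0 ≤ radialExt (zeroProfile R) c a q := by
  unfold radialExt
  split_ifs
  · exact zeroProfile_nonneg hR (norm_nonneg _)
  · exact zero_le_one

theorem radialExt_zero_le (hR : 0 < R) (q : X) : radialExt (zeroProfile R) c a q ≤ Real.exp 1 := by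
  unfold radialExt
  split_ifs
  · exact zeroProfile_le_exp hR (norm_nonneg _)
  · exact Real.one_le_exp zero_le_one

theorem continuous_radialExt_zero (hR : 0 < R) (hRt : Metric.closedBall (c a) R ⊆ c.target) :
    Continuous (radialExt (zeroProfile R) c a) :=
  continuous_iff_continuousAt.2 fun _ => continuousAt_radialExt hRt (zeroProfile_of_ge hR)
    fun _ => (continuous_zeroProfile R).continuousAt

/-- The factor with a zero at `a` fails to be log-subharmonic by `exp (-r² / R²)`. The `m`-th power
of the strict function has `exp (m ε ‖c‖²)` to spare, which compensates when `m ε ≥ 1 / R²`. From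
the seam outwards the factor is 1 at `q` and at least 1 near `q`, so `P ^ m` is a support. -/
theorem logSubAt_pow_mul_radialExt_zero {P : X → ℝ} {ε : ℝ} {m : ℕ} (hc : c ∈ atlas ℂ X)
    (hR : 0 < R) (hm : 1 / R ^ 2 ≤ m * ε)
    (hRt : Metric.closedBall (c a) R ⊆ c.target) {q : X} (hP0 : ∀ᶠ w in 𝓝 q, 0 ≤ P w)
    (hPq : LogSubAt P q) (hstrict : q ∈ c.source → ‖c q - c a‖ < R →
      LogSubAt (fun w => P w * Real.exp (-ε * ‖c w‖ ^ 2)) q) :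
    LogSubAt (fun w => P w ^ m * radialExt (zeroProfile R) c a w) q := by
  by_cases hin : q ∈ c.source ∧ ‖c q - c a‖ < R
  · obtain ⟨hqs, hqR⟩ := hin
    have hch := eventually_mdifferentiableAt_chart hc hqs
    let g : ℂ → ℂ := fun z => (z - c a) / R *
      Complex.exp (1 / R ^ 2 * (R ^ 2 - (‖c a‖ : ℂ) ^ 2 + 2 * (starRingEnd ℂ (c a) * z)))
    have h1 := ((hstrict hqs hqR).pow m).mul
      (LogSubAt.exp_normSq (β := m * ε - 1 / R ^ 2) (by linarith) hch)
    have h2 : LogSubAt (fun w => ‖g (c w)‖) q := LogSubAt.norm <| by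
      filter_upwards [hch] with w hw
      refine mdifferentiableAt_comp_differentiable g ?_ hw
      fun_prop
    refine (h1.mul h2).congr ?_
    have h3 : ContinuousAt (fun w => ‖c w - c a‖) q :=
      ((c.continuousAt hqs).sub continuousAt_const).norm
    filter_upwards [c.open_source.mem_nhds hqs, h3.eventually (gt_mem_nhds hqR)] with w hws hwR
    rw [radialExt_of_mem hws, zeroProfile, min_eq_left hwR.le]
    simp only [g, norm_mul, norm_div, Complex.norm_real, Real.norm_eq_abs, abs_of_pos hR,
      Complex.norm_exp]
    rw [mul_pow, ← Real.exp_nat_mul, mul_assoc, mul_assoc, mul_left_comm (Real.exp _) (_ / R),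
      mul_left_comm (Real.exp _) (_ / R), ← Real.exp_add, ← Real.exp_add]
    congr 3
    have h5 : ((1 : ℂ) / (R ^ 2)) = ((1 / (R ^ 2) : ℝ) : ℂ) := by push_cast; ring
    rw [h5, Complex.re_ofReal_mul]
    have h1 : ‖c w - c a‖ ^ 2 = (c w - c a).re * (c w - c a).re + (c w - c a).im * (c w - c a).im := by
      rw [← Complex.normSq_eq_norm_sq, Complex.normSq_apply]
    have h2 : ‖c w‖ ^ 2 = (c w).re * (c w).re + (c w).im * (c w).im := by
      rw [← Complex.normSq_eq_norm_sq, Complex.normSq_apply]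
    have h3 : ‖c a‖ ^ 2 = (c a).re * (c a).re + (c a).im * (c a).im := by
      rw [← Complex.normSq_eq_norm_sq, Complex.normSq_apply]
    have h4 : ((‖c a‖ : ℂ) ^ 2).re = ‖c a‖ ^ 2 := by norm_cast
    have h6 : ((R : ℂ) ^ 2).re = R ^ 2 := by norm_cast
    simp only [Complex.sub_re, Complex.add_re, h4, h6, Complex.mul_re, Complex.re_ofNat,
      Complex.im_ofNat, Complex.conj_re, Complex.conj_im, Complex.sub_im] at *
    rw [h1, h2, h3]
    field_simp
    ring
  · have hJ1 : radialExt (zeroProfile R) c a q = 1 := by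
      by_cases hqs : q ∈ c.source
      · rw [radialExt_of_mem hqs, zeroProfile_of_ge hR]
        by_contra h
        exact hin ⟨hqs, not_le.1 h⟩
      · exact if_neg hqs
    have hJ : ∀ᶠ w in 𝓝 q, 1 ≤ radialExt (zeroProfile R) c a w := by
      by_cases hqs : q ∈ c.source
      · have hqR : R ≤ ‖c q - c a‖ := by
          by_contra h
          exact hin ⟨hqs, not_le.1 h⟩
        have h3 : ContinuousAt (fun w => ‖c w - c a‖) q :=
          ((c.continuousAt hqs).sub continuousAt_const).norm
        have h4 : ContinuousAt (fun w => ‖c w - c a‖ ^ 2) q := h3.pow 2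
        filter_upwards [c.open_source.mem_nhds hqs, h3.eventually (lt_mem_nhds (hR.trans_le hqR)),
          h4.eventually (lt_mem_nhds (show R ^ 2 / 2 < _ by nlinarith))] with w hw hw1 hw2
        rw [radialExt_of_mem hw]
        exact one_le_zeroProfile hR hw2.le hw1
      · exact (radialExt_eq_one hRt (zeroProfile_of_ge hR) fun h => absurd h hqs).mono fun w h => h.ge
    refine (hPq.pow m).mono (by rw [hJ1, mul_one]) ?_
    filter_upwards [hP0, hJ] with w hw1 hw2
    exact le_mul_of_one_le_right (pow_nonneg hw1 m) hw2

end

/-- A uniform Schwarz lemma for holomorphic discs in a compact Riemann surface that avoid an open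
neighbourhood of the poles of a strictly subharmonic function. -/
theorem exists_uniform_schwarz [CompactSpace X] {S : Finset X} {P : X → ℝ}
    (hP : ∀ q ∉ S, ContinuousAt P q ∧ 1 ≤ P q ∧ LogSubAt P q ∧ StrictLogSubAt P q)
    {G : Set X} (hG : IsOpen G) (hSG : ↑S ⊆ G) {a₀ : X} (ha₀ : a₀ ∉ S) {N : Set X} (hN : N ∈ 𝓝 a₀) :
    ∃ δ : ℝ, 0 < δ ∧ ∃ N' ∈ 𝓝 a₀, ∀ u : ℂ → X,
      MDifferentiableOn 𝓘(ℂ) 𝓘(ℂ) u (Metric.ball 0 1) → (∀ t ∈ Metric.ball (0 : ℂ) 1, u t ∉ G) →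
      u 0 ∈ N' → ∀ t : ℂ, ‖t‖ < δ → u t ∈ N := by
  obtain ⟨c, hc, hac, ε, hε, hstr⟩ := (hP a₀ ha₀).2.2.2
  obtain ⟨V, hVsub, hVo, haV⟩ := mem_nhds_iff.1
    (inter_mem (inter_mem hstr hN) (c.open_source.mem_nhds hac))
  have hVs : V ⊆ c.source := fun q hq => (hVsub hq).2
  have hVimg : IsOpen (c '' V) := c.isOpen_image_of_subset_source hVo hVs
  obtain ⟨R₁, hR₁, hRV⟩ := Metric.isOpen_iff.1 hVimg (c a₀) (mem_image_of_mem c haV)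
  set R := R₁ / 3 with hRdef
  have hR : 0 < R := by positivity
  have hball : ∀ q ∈ c.source, dist (c q) (c a₀) < R₁ → q ∈ V := by
    intro q hq hd
    obtain ⟨v, hv, hvq⟩ := hRV hd
    rwa [← c.injOn (hVs hv) hq hvq]
  obtain ⟨m, hm⟩ := exists_nat_ge (1 / R ^ 2 / ε)
  have hm' : 1 / R ^ 2 ≤ m * ε := (div_le_iff₀ hε).1 hm
  obtain ⟨B, hB⟩ : ∃ B, ∀ q ∉ G, P q ≤ B := by
    have hK : IsCompact Gᶜ := hG.isClosed_compl.isCompact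
    obtain ⟨B, hB⟩ := hK.bddAbove_image (f := P) fun q hq =>
      (hP q fun h => hq (hSG h)).1.continuousWithinAt
    exact ⟨B, fun q hq => hB (mem_image_of_mem P hq)⟩
  set B' := (max B 0 ^ m * Real.exp 1) ^ 2 with hB'
  have hB'0 : 0 ≤ B' := by positivity
  -- The maximum principle on the disc of radius 1/2 will give `Q (u t) ^ 2 ≤ 2 B' ‖t‖`, and this
  -- `δ` makes the right side less than 1.
  refine ⟨min (1 / 2) (1 / (2 * (B' + 1))), by positivity,
    c.source ∩ c ⁻¹' Metric.ball (c a₀) R,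
    (c.continuousOn.isOpen_inter_preimage c.open_source Metric.isOpen_ball).mem_nhds
      ⟨hac, Metric.mem_ball_self hR⟩, ?_⟩
  rintro u hu huG ⟨has, haR⟩ t ht
  set a := u 0 with hadef
  have haR' : dist (c a) (c a₀) < R := haR
  have hRt : Metric.closedBall (c a) R ⊆ c.target := by
    refine Subset.trans ?_ (hRV.trans ?_)
    · refine (Metric.closedBall_subset_ball' ?_)
      linarith
    · rintro _ ⟨v, hv, rfl⟩
      exact c.map_source (hVs hv)
  set J := radialExt (zeroProfile R) c a with hJ
  have huS : ∀ t ∈ Metric.ball (0 : ℂ) 1, u t ∉ S := fun t ht h => huG t ht (hSG h)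
  have hud : ∀ t ∈ Metric.ball (0 : ℂ) 1, ∀ᶠ s in 𝓝 t, MDifferentiableAt 𝓘(ℂ) 𝓘(ℂ) u s := by
    intro t ht
    filter_upwards [Metric.isOpen_ball.mem_nhds ht] with s hs
    exact hu.mdifferentiableAt (Metric.isOpen_ball.mem_nhds hs)
  have huc : ∀ t ∈ Metric.ball (0 : ℂ) 1, ContinuousAt u t := fun t ht =>
    (hud t ht).self_of_nhds.continuousAt
  let Q : X → ℝ := fun q => P q ^ m * J q
  have hQsub : ∀ q ∉ S, LogSubAt Q q := by
    intro q hq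
    refine logSubAt_pow_mul_radialExt_zero hc hR hm' hRt ?_ (hP q hq).2.2.1 fun hqs hqR => ?_
    · filter_upwards [S.finite_toSet.isClosed.isOpen_compl.mem_nhds hq] with w hw
      exact zero_le_one.trans (hP w hw).2.1
    · refine (hVsub (hball q hqs ?_)).1.1
      rw [← dist_eq_norm] at hqR
      calc _ ≤ _ := dist_triangle (c q) (c a) (c a₀)
        _ < R₁ := by linarith
  have hQ0 : ∀ q ∉ S, 0 ≤ Q q := fun q hq =>
    mul_nonneg (pow_nonneg (zero_le_one.trans (hP q hq).2.1) m) (radialExt_zero_nonneg hR q)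
  have hQJ : ∀ q ∉ S, J q ≤ Q q := fun q hq =>
    le_mul_of_one_le_left (radialExt_zero_nonneg hR q) (one_le_pow₀ (hP q hq).2.1)
  have hPB : ∀ q ∉ G, P q ^ m ≤ max B 0 ^ m := fun q hq =>
    pow_le_pow_left₀ (zero_le_one.trans (hP q fun h => hq (hSG h)).2.1)
      ((hB q hq).trans (le_max_left _ _)) m
  have hQB : ∀ q ∉ G, Q q ^ 2 ≤ B' := by
    intro q hq
    refine pow_le_pow_left₀ (hQ0 q fun h => hq (hSG h)) ?_ 2
    exact mul_le_mul (hPB q hq) (radialExt_zero_le hR q) (radialExt_zero_nonneg hR q) (by positivity)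
  have hQc : ∀ q ∉ S, ContinuousAt Q q := fun q hq =>
    ((hP q hq).1.pow m).mul (continuous_radialExt_zero hR hRt).continuousAt
  -- Since `Q (u t) = O(‖t‖)`, the square makes `L` tend to 0 at the origin. The convention `0⁻¹ =
  -- 0` gives `L 0 = 0`, so `L` is continuous and trivially log-subharmonic there.
  let L : ℂ → ℝ := fun t => Q (u t) ^ 2 * ‖t⁻¹‖
  have hL0 : ∀ t ∈ Metric.ball (0 : ℂ) 1, 0 ≤ L t := fun t ht => by positivity
  have h0mem : (0 : ℂ) ∈ Metric.ball (0 : ℂ) 1 := by simp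
  have hLc0 : ContinuousAt L 0 := by
    have hL00 : L 0 = 0 := by simp [L]
    rw [ContinuousAt, hL00]
    have hdiff : DifferentiableAt ℂ (fun s => c (u s)) 0 := by
      rw [← mdifferentiableAt_iff_differentiableAt]
      exact (mdifferentiableAt_atlas hc has).comp (0 : ℂ) (hud 0 h0mem).self_of_nhds
    obtain ⟨C, hC0, hC⟩ := hdiff.isBigO_sub.exists_pos
    have hCb := hC.bound
    set D := (max B 0 ^ m * (C / R * Real.exp 1)) ^ 2
    have hlim : Tendsto (fun t : ℂ => D * ‖t‖) (𝓝 0) (𝓝 0) := by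
      have : Continuous fun t : ℂ => D * ‖t‖ := by fun_prop
      simpa using this.tendsto 0
    refine tendsto_of_tendsto_of_tendsto_of_le_of_le' tendsto_const_nhds hlim ?_ ?_
    · filter_upwards [Metric.isOpen_ball.mem_nhds h0mem] with t ht using hL0 t ht
    · filter_upwards [Metric.isOpen_ball.mem_nhds h0mem, hCb,
        (huc 0 h0mem).eventually (c.open_source.mem_nhds has)] with t ht1 ht2 ht3
      simp only [sub_zero] at ht2
      have h1 : J (u t) ≤ C / R * Real.exp 1 * ‖t‖ := by
        rw [hJ, radialExt_of_mem ht3]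
        refine (zeroProfile_le hR (norm_nonneg _)).trans ?_
        calc ‖c (u t) - c a‖ / R * Real.exp 1 ≤ C * ‖t‖ / R * Real.exp 1 := by gcongr
          _ = _ := by ring
      have h2 : Q (u t) ≤ max B 0 ^ m * (C / R * Real.exp 1) * ‖t‖ := by
        rw [mul_assoc]
        exact mul_le_mul (hPB _ (huG t ht1)) h1 (radialExt_zero_nonneg hR _) (by positivity)
      have h3 : Q (u t) ^ 2 ≤ D * ‖t‖ ^ 2 := by
        rw [← mul_pow]
        exact pow_le_pow_left₀ (hQ0 _ (huS t ht1)) h2 2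
      rcases eq_or_ne t 0 with rfl | hne
      · simp [L]
      · have hn : 0 < ‖t‖ := norm_pos_iff.2 hne
        simp only [L, norm_inv]
        rw [← div_eq_mul_inv, div_le_iff₀ hn]
        linarith
  have hsub : Metric.closedBall (0 : ℂ) (1 / 2) ⊆ Metric.ball 0 1 :=
    Metric.closedBall_subset_ball (by norm_num)
  have hmax := le_of_logSubAt_of_le_on_sphere (L := L) (ρ := 1 / 2) (B := 2 * B') ?_ ?_ ?_
  rotate_left
  · intro s hs
    refine ContinuousAt.continuousWithinAt ?_
    rcases eq_or_ne s 0 with rfl | hne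
    · exact hLc0
    · exact ((ContinuousAt.comp (f := u) (hQc _ (huS s (hsub hs))) (huc s (hsub hs))).pow 2).mul
        (continuousAt_inv₀ hne).norm
  · intro s hs
    have hs1 := hsub (Metric.ball_subset_closedBall hs)
    rcases eq_or_ne s 0 with rfl | hne
    · refine LogSubAt.of_eq_zero (by simp [L]) ?_
      filter_upwards [Metric.isOpen_ball.mem_nhds h0mem] with t ht using hL0 t ht
    · refine (((hQsub _ (huS s hs1)).comp (hud s hs1)).pow 2).mul (LogSubAt.norm ?_)
      filter_upwards [isOpen_ne.mem_nhds hne] with w hw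
      exact mdifferentiableAt_iff_differentiableAt.2 (differentiableAt_inv hw)
  · intro s hs
    have hs1 := hsub (Metric.sphere_subset_closedBall hs)
    simp only [L, norm_inv, mem_sphere_zero_iff_norm.1 hs]
    have := hQB _ (huG s hs1)
    norm_num
    linarith
  have ht1 : ‖t‖ < 1 / 2 := ht.trans_le (min_le_left _ _)
  have ht2 : ‖t‖ < 1 / (2 * (B' + 1)) := ht.trans_le (min_le_right _ _)
  have htb : t ∈ Metric.ball (0 : ℂ) 1 := by simp; linarith
  rcases eq_or_ne t 0 with rfl | hne
  · refine (hVsub (hball _ has ?_)).1.2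
    linarith
  have hn : 0 < ‖t‖ := norm_pos_iff.2 hne
  have hfin := hmax t (by simpa using ht1.le)
  have hlt : Q (u t) ^ 2 < 1 := by
    simp only [L, norm_inv] at hfin
    rw [← div_eq_mul_inv, div_le_iff₀ hn] at hfin
    rw [lt_div_iff₀ (by positivity)] at ht2
    nlinarith
  -- `J ≤ Q` because `P ≥ 1`, while `J = 1` outside the disc; hence `u t` lies within `R` of `a`.
  have hJlt : J (u t) < 1 := by
    have h1 := hQJ _ (huS t htb)
    have h2 := radialExt_zero_nonneg (c := c) (a := a) hR (u t)
    by_contra h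
    push Not at h
    nlinarith [h.trans h1]
  have hus : u t ∈ c.source := by
    by_contra h
    exact absurd (if_neg h) hJlt.ne
  have huR : ‖c (u t) - c a‖ < R := by
    by_contra h
    rw [hJ, radialExt_of_mem hus, zeroProfile_of_ge hR _ (not_lt.1 h)] at hJlt
    exact lt_irrefl _ hJlt
  refine (hVsub (hball _ hus ?_)).1.2
  rw [← dist_eq_norm] at huR
  calc _ ≤ _ := dist_triangle (c (u t)) (c a) (c a₀)
    _ < R₁ := by linarith

end Schwarz

/-! ### Joint continuity of pointwise holomorphic families of homeomorphisms -/

section JointContinuity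

variable {X : Type*} [TopologicalSpace X] [T2Space X] [CompactSpace X] [ChartedSpace ℂ X]
  [IsManifold 𝓘(ℂ) 1 X]
  {V : Type*} [NormedAddCommGroup V] [NormedSpace ℂ V]

omit [T2Space X] [CompactSpace X] [IsManifold 𝓘(ℂ) 1 X] in
theorem exists_ne_of_isOpen {B : Set X} (hB : IsOpen B) (hne : B.Nonempty) (x₀ : X) :
    ∃ x ∈ B, x ≠ x₀ := by
  obtain ⟨v, hv⟩ := hne
  set c := chartAt ℂ v
  have hvs : v ∈ c.source := mem_chart_source ℂ v
  have hopen : IsOpen (c.target ∩ c.symm ⁻¹' B) :=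
    c.continuousOn_symm.isOpen_inter_preimage c.open_target hB
  have hmem : c v ∈ c.target ∩ c.symm ⁻¹' B := ⟨c.map_source hvs, by simpa [c.left_inv hvs]⟩
  by_contra hall
  push Not at hall
  have hsing : c.target ∩ c.symm ⁻¹' B ⊆ {c v} := by
    intro z hz
    have h1 := hall _ hz.2
    have h2 := hall v hv
    rw [mem_singleton_iff, ← c.right_inv hz.1, h1, h2]
  have : c.target ∩ c.symm ⁻¹' B = {c v} := hsing.antisymm (singleton_subset_iff.2 hmem)
  rw [this] at hopen
  exact not_isOpen_singleton (c v) hopen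

omit [IsManifold 𝓘(ℂ) 1 X] in
/-- The union of the sets where a pointwise holomorphic family stays in a chart for a uniform time
is dense. -/
theorem exists_open_uniform_chart {Φ : V → X ≃ₜ X} {τ₀ : V} {r : ℝ} (hr : 0 < r)
    (h : ∀ x, MDifferentiableOn 𝓘(ℂ, V) 𝓘(ℂ) (fun τ => Φ τ x) (Metric.ball τ₀ r))
    {B : Set X} (hB : IsOpen B) (hne : B.Nonempty) :
    ∃ c ∈ atlas ℂ X, ∃ (b : ℂ) (R r₁ : ℝ), 0 < R ∧ 0 < r₁ ∧ r₁ ≤ r ∧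
      ∃ B₁ ⊆ B, IsOpen B₁ ∧ B₁.Nonempty ∧ ∀ τ ∈ Metric.ball τ₀ r₁, ∀ x ∈ B₁,
        Φ τ x ∈ c.source ∧ c (Φ τ x) ∈ Metric.closedBall b R := by
  obtain ⟨x, hx⟩ := hne
  set c := chartAt ℂ (Φ τ₀ x)
  have hs : Φ τ₀ x ∈ c.source := mem_chart_source ℂ _
  set b := c (Φ τ₀ x)
  obtain ⟨R, hR, hRt⟩ := Metric.nhds_basis_closedBall.mem_iff.1
    (c.open_target.mem_nhds (c.map_source hs))
  set Q := c.symm '' Metric.closedBall b R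
  have hQc : IsClosed Q :=
    ((isCompact_closedBall _ _).image_of_continuousOn (c.continuousOn_symm.mono hRt)).isClosed
  have hQ : ∀ y ∈ Q, y ∈ c.source ∧ c y ∈ Metric.closedBall b R := by
    rintro _ ⟨z, hz, rfl⟩
    exact ⟨c.map_target (hRt hz), by rwa [c.right_inv (hRt hz)]⟩
  set O := c.source ∩ c ⁻¹' Metric.ball b R
  have hO : IsOpen O := c.continuousOn.isOpen_inter_preimage c.open_source Metric.isOpen_ball
  have hOQ : O ⊆ Q := fun y hy => ⟨c y, Metric.ball_subset_closedBall hy.2, c.left_inv hy.1⟩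
  set B' := B ∩ Φ τ₀ ⁻¹' O
  have hB' : IsOpen B' := hB.inter (hO.preimage (Φ τ₀).continuous)
  have hxB' : x ∈ B' := ⟨hx, hs, Metric.mem_ball_self hR⟩
  -- Baire category: pointwise continuity in the parameter puts each point of `B'` in some `A n`.
  -- Adding the complement of `B'` makes these closed sets cover `X`.
  let A : ℕ → Set X := fun n => B'ᶜ ∪ ⋂ τ ∈ Metric.ball τ₀ (min r (1 / (n + 1))), Φ τ ⁻¹' Q
  have hA : ∀ n, IsClosed (A n) := fun n =>
    hB'.isClosed_compl.union (isClosed_biInter fun τ _ => hQc.preimage (Φ τ).continuous)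
  have hcov : ⋃ n, A n = univ := by
    refine eq_univ_of_forall fun y => mem_iUnion.2 ?_
    by_cases hy : y ∈ B'
    · have hcont : ContinuousAt (fun τ => Φ τ y) τ₀ :=
        ((h y).continuousOn.continuousAt (Metric.ball_mem_nhds τ₀ hr))
      obtain ⟨d, hd, hd'⟩ := Metric.eventually_nhds_iff.1 (hcont.eventually (hO.mem_nhds hy.2))
      obtain ⟨n, hn⟩ := exists_nat_one_div_lt hd
      refine ⟨n, Or.inr (mem_iInter₂.2 fun τ hτ => hOQ (hd' ?_))⟩
      exact (Metric.mem_ball.1 hτ).trans ((min_le_right _ _).trans_lt hn)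
    · exact ⟨0, Or.inl hy⟩
  obtain ⟨y, hyB', hy⟩ := (dense_iUnion_interior_of_closed hA hcov).inter_open_nonempty B' hB' ⟨x, hxB'⟩
  obtain ⟨n, hn⟩ := mem_iUnion.1 hy
  refine ⟨c, chart_mem_atlas ℂ _, b, R, min r (1 / (n + 1)), hR, by positivity, min_le_left _ _,
    B' ∩ interior (A n), inter_subset_left.trans inter_subset_left, hB'.inter isOpen_interior,
    ⟨y, hyB', hn⟩, fun τ hτ z hz => hQ _ ?_⟩
  rcases interior_subset hz.2 with h1 | h1
  · exact absurd hz.1 h1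
  · exact mem_iInter₂.1 h1 τ hτ

/-- On a smaller open set the orbits stay in one chart disc for a uniform time, so they are
uniformly Lipschitz in the parameter. Hence the image of that set under `Φ τ` still covers a fixed
small ball, and injectivity of `Φ τ` keeps all points outside `B` away from this ball. -/
theorem exists_omitted_open {Φ : V → X ≃ₜ X} {τ₀ : V} {r : ℝ} (hr : 0 < r)
    (h : ∀ x, MDifferentiableOn 𝓘(ℂ, V) 𝓘(ℂ) (fun τ => Φ τ x) (Metric.ball τ₀ r))
    {B : Set X} (hB : IsOpen B) (hne : B.Nonempty) :
    ∃ x₁ ∈ B, ∃ G : Set X, IsOpen G ∧ Φ τ₀ x₁ ∈ G ∧ ∃ r₂ : ℝ, 0 < r₂ ∧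
      ∀ τ ∈ Metric.ball τ₀ r₂, ∀ x ∉ B, Φ τ x ∉ G := by
  obtain ⟨c, hc, b, R, r₁, hR, hr₁, hr₁r, B₁, hB₁B, hB₁, ⟨x₁, hx₁⟩, hch⟩ :=
    exists_open_uniform_chart hr h hB hne
  have hτ₀ : τ₀ ∈ Metric.ball τ₀ r₁ := Metric.mem_ball_self hr₁
  set y₁ := c (Φ τ₀ x₁) with hy₁
  have hs₁ : Φ τ₀ x₁ ∈ c.source := (hch τ₀ hτ₀ x₁ hx₁).1
  have hlip : ∀ x ∈ B₁, ∀ τ ∈ Metric.ball τ₀ r₁,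
      dist (c (Φ τ x)) (c (Φ τ₀ x)) ≤ 2 * R / r₁ * dist τ τ₀ := by
    intro x hx τ hτ
    refine Complex.dist_le_div_mul_dist_of_mapsTo_ball (f := fun τ => c (Φ τ x)) ?_ ?_ hτ
    · intro σ hσ
      have h1 : MDifferentiableAt 𝓘(ℂ, V) 𝓘(ℂ) (fun τ => Φ τ x) σ :=
        (h x).mdifferentiableAt (Metric.isOpen_ball.mem_nhds (Metric.ball_subset_ball hr₁r hσ))
      exact (mdifferentiableAt_iff_differentiableAt.1
        ((mdifferentiableAt_atlas hc (hch σ hσ x hx).1).comp σ h1)).differentiableWithinAt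
    · intro σ hσ
      have h1 := (hch σ hσ x hx).2
      have h2 := (hch τ₀ hτ₀ x hx).2
      rw [Metric.mem_closedBall] at h1 h2 ⊢
      calc _ ≤ _ := dist_triangle_right _ _ b
        _ ≤ 2 * R := by linarith
  have hW : IsOpen (c.target ∩ c.symm ⁻¹' (Φ τ₀ '' B₁)) :=
    c.continuousOn_symm.isOpen_inter_preimage c.open_target ((Φ τ₀).isOpenMap _ hB₁)
  obtain ⟨ρ, hρ, hρW⟩ := Metric.nhds_basis_closedBall.mem_iff.1
    (hW.mem_nhds (show y₁ ∈ _ from ⟨c.map_source hs₁, by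
      rw [mem_preimage, hy₁, c.left_inv hs₁]; exact mem_image_of_mem _ hx₁⟩))
  have hρt : Metric.closedBall y₁ ρ ⊆ c.target := fun z hz => (hρW hz).1
  set K := Φ τ₀ ⁻¹' (c.symm '' Metric.closedBall y₁ ρ)
  have hK : IsClosed K := (((isCompact_closedBall _ _).image_of_continuousOn
    (c.continuousOn_symm.mono hρt)).isClosed).preimage (Φ τ₀).continuous
  have hKB : ∀ x ∈ K, x ∈ B₁ ∧ c (Φ τ₀ x) ∈ Metric.closedBall y₁ ρ := by
    rintro x ⟨z, hz, hzx⟩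
    refine ⟨?_, by rwa [← hzx, c.right_inv (hρt hz)]⟩
    obtain ⟨x', hx', hxx'⟩ := (hρW hz).2
    rw [hzx] at hxx'
    rwa [← (Φ τ₀).injective hxx']
  set B' := Φ τ₀ ⁻¹' (c.source ∩ c ⁻¹' Metric.ball y₁ ρ)
  have hB' : IsOpen B' :=
    (c.continuousOn.isOpen_inter_preimage c.open_source Metric.isOpen_ball).preimage (Φ τ₀).continuous
  have hB'K : B' ⊆ K := fun x hx => ⟨_, Metric.ball_subset_closedBall hx.2, c.left_inv hx.1⟩
  set r₂ := min r₁ (ρ / 2 / (2 * R / r₁ + 1))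
  have hr₂ : 0 < r₂ := by positivity
  refine ⟨x₁, hB₁B hx₁, c.source ∩ c ⁻¹' Metric.ball y₁ (ρ / 2),
    c.continuousOn.isOpen_inter_preimage c.open_source Metric.isOpen_ball,
    ⟨hs₁, Metric.mem_ball_self (by positivity)⟩, r₂, hr₂, ?_⟩
  rintro τ hτ x hx ⟨hxs, hxball⟩
  have hτ₁ : τ ∈ Metric.ball τ₀ r₁ := Metric.ball_subset_ball (min_le_left _ _) hτ
  have hsmall : ∀ x ∈ B₁, dist (c (Φ τ x)) (c (Φ τ₀ x)) < ρ / 2 := by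
    intro x hx
    refine (hlip x hx τ hτ₁).trans_lt ?_
    have h1 : dist τ τ₀ < ρ / 2 / (2 * R / r₁ + 1) := (Metric.mem_ball.1 hτ).trans_le (min_le_right _ _)
    rw [lt_div_iff₀ (by positivity)] at h1
    have := dist_nonneg (x := τ) (y := τ₀)
    nlinarith
  -- Covering by connectedness: `A₁` and `A₂` are disjoint, open, and cover the ball, since a point
  -- of `K` landing in the ball moved less than `ρ / 2` and so came from `B'`. The image of `x₁`
  -- shows that `A₁` meets the ball, so `A₁` contains it.
  set A₁ := c.target ∩ c.symm ⁻¹' (Φ τ '' B')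
  set A₂ := c.target ∩ c.symm ⁻¹' (Φ τ '' K)ᶜ
  have hA₁ : IsOpen A₁ :=
    c.continuousOn_symm.isOpen_inter_preimage c.open_target ((Φ τ).isOpenMap _ hB')
  have hA₂ : IsOpen A₂ :=
    c.continuousOn_symm.isOpen_inter_preimage c.open_target ((Φ τ).isClosedMap _ hK).isOpen_compl
  have hdisj : Disjoint A₁ A₂ := by
    rw [Set.disjoint_left]
    rintro z ⟨-, x, hx, hxz⟩ ⟨-, hz⟩
    exact hz ⟨x, hB'K hx, hxz⟩
  have hballt : Metric.ball y₁ (ρ / 2) ⊆ c.target :=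
    (Metric.ball_subset_closedBall.trans (Metric.closedBall_subset_closedBall (by linarith))).trans hρt
  have hsub : Metric.ball y₁ (ρ / 2) ⊆ A₁ ∪ A₂ := by
    intro z hz
    by_cases hzK : c.symm z ∈ Φ τ '' K
    · left
      refine ⟨hballt hz, ?_⟩
      obtain ⟨x, hxK, hxz⟩ := hzK
      refine ⟨x, ⟨(hch τ₀ hτ₀ x (hKB x hxK).1).1, ?_⟩, hxz⟩
      have h1 := hsmall x (hKB x hxK).1
      rw [hxz, c.right_inv (hballt hz)] at h1
      calc dist (c (Φ τ₀ x)) y₁ ≤ _ := dist_triangle_left _ _ z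
        _ < ρ := by have := Metric.mem_ball.1 hz; linarith
    · exact Or.inr ⟨hballt hz, hzK⟩
  have hconn : IsPreconnected (Metric.ball y₁ (ρ / 2)) := (convex_ball _ _).isPreconnected
  have hsubA₁ := hconn.subset_left_of_subset_union hA₁ hA₂ hdisj hsub
    ⟨c (Φ τ x₁), hsmall x₁ hx₁, c.map_source (hch τ hτ₁ x₁ hx₁).1, x₁,
      ⟨hs₁, Metric.mem_ball_self hρ⟩, by rw [c.left_inv (hch τ hτ₁ x₁ hx₁).1]⟩
  obtain ⟨-, x', hx', hxx'⟩ := hsubA₁ hxball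
  rw [c.left_inv hxs] at hxx'
  exact hx (hB₁B ((Φ τ).injective hxx' ▸ (hKB x' (hB'K hx')).1))

/-- A family of homeomorphisms of a compact Riemann surface that depends pointwise holomorphically
on the parameter is jointly continuous. -/
theorem continuousAt_uncurry_of_mdifferentiableOn {Φ : V → X ≃ₜ X} {τ₀ : V} {r : ℝ} (hr : 0 < r)
    (h : ∀ x, MDifferentiableOn 𝓘(ℂ, V) 𝓘(ℂ) (fun τ => Φ τ x) (Metric.ball τ₀ r)) (x₀ : X) :
    ContinuousAt (fun q : V × X => Φ q.1 q.2) (τ₀, x₀) := by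
  classical
  -- These are the admissible poles: the orbits of points near `x₀`, which lie outside `B`, omit a
  -- neighbourhood of `y` for a uniform time.
  set D : Set X := {y | ∃ (B G : Set X) (r₂ : ℝ), x₀ ∉ closure B ∧ (Φ τ₀).symm y ∈ B ∧ IsOpen G ∧
    y ∈ G ∧ 0 < r₂ ∧ ∀ τ ∈ Metric.ball τ₀ r₂, ∀ x ∉ B, Φ τ x ∉ G}
  have hD : Dense D := by
    rw [dense_iff_inter_open]
    intro O hO hOne
    have hO' : IsOpen (Φ τ₀ ⁻¹' O) := hO.preimage (Φ τ₀).continuous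
    obtain ⟨x, hx, hxx₀⟩ := exists_ne_of_isOpen hO' (hOne.preimage (Φ τ₀).surjective) x₀
    obtain ⟨u, v, hu, hv, hxu, hxv, huv⟩ := t2_separation hxx₀
    obtain ⟨x₁, ⟨hx₁, hx₁u⟩, G, hG, hxG, r₂, hr₂, hom⟩ :=
      exists_omitted_open hr h (hO'.inter hu) ⟨x, hx, hxu⟩
    refine ⟨Φ τ₀ x₁, hx₁, _, G, r₂, ?_, by simpa using ⟨hx₁, hx₁u⟩, hG, hxG, hr₂, hom⟩
    intro hcl
    obtain ⟨w, hwv, -, hwu⟩ := mem_closure_iff.1 hcl v hv hxv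
    exact Set.disjoint_left.1 huv hwu hwv
  obtain ⟨S, P, hSD, hP⟩ := exists_strictLogSub_potential hD
  choose! B G r₂ hcl hB hG hyG hr₂ hom using fun y (hy : y ∈ D) => hy
  have hSmem : ∀ y ∈ S, y ∈ D := fun y hy => hSD hy
  obtain ⟨ρ, hρ, hρr, hρS⟩ : ∃ ρ, 0 < ρ ∧ ρ ≤ r ∧ ∀ y ∈ S, ρ ≤ r₂ y := by
    rcases S.eq_empty_or_nonempty with hS | hS
    · exact ⟨r, hr, le_rfl, by simp [hS]⟩
    · refine ⟨min r (S.inf' hS r₂), lt_min hr ((Finset.lt_inf'_iff hS).2 fun y hy => hr₂ y (hSmem y hy)),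
        min_le_left _ _, fun y hy => (min_le_right _ _).trans (Finset.inf'_le _ hy)⟩
  have hx₀S : Φ τ₀ x₀ ∉ S := by
    intro hmem
    have := hB _ (hSmem _ hmem)
    rw [Homeomorph.symm_apply_apply] at this
    exact hcl _ (hSmem _ hmem) (subset_closure this)
  intro N hN
  rw [mem_map]
  obtain ⟨δ, hδ, N', hN', hsch⟩ := exists_uniform_schwarz hP (G := ⋃ y ∈ S, G y)
    (isOpen_biUnion fun y hy => hG y (hSmem y hy))
    (fun y hy => mem_biUnion (Finset.mem_coe.1 hy) (hyG y (hSmem y hy))) hx₀S hN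
  have hx : ∀ᶠ x in 𝓝 x₀, Φ τ₀ x ∈ N' ∧ ∀ y ∈ S, x ∉ B y := by
    refine ((Φ τ₀).continuous.continuousAt.eventually hN').and
      ((Finset.eventually_all S).2 fun y hy => ?_)
    filter_upwards [isClosed_closure.isOpen_compl.mem_nhds (hcl y (hSmem y hy))] with x hx hxB
    exact hx (subset_closure hxB)
  have hτ : ∀ᶠ τ in 𝓝 τ₀, τ ∈ Metric.ball τ₀ (ρ * (δ / 2)) := Metric.ball_mem_nhds _ (by positivity)
  filter_upwards [hτ.prod_nhds hx] with ⟨τ, x⟩ ⟨hτ, hxN', hxB⟩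
  -- The holomorphic disc `t ↦ τ₀ + t • w` passes through `τ` at `t = δ / 2 < δ`, and `‖w‖ < ρ`
  -- keeps it in the ball where the omissions hold.
  set w : V := ((δ / 2 : ℝ) : ℂ)⁻¹ • (τ - τ₀) with hw
  have hw1 : ‖w‖ < ρ := by
    rw [Metric.mem_ball, dist_eq_norm] at hτ
    rw [hw, norm_smul, norm_inv, Complex.norm_real, Real.norm_eq_abs, abs_of_pos (by positivity),
      ← div_eq_inv_mul, div_lt_iff₀ (by positivity)]
    exact hτ
  have hmaps : ∀ t ∈ Metric.ball (0 : ℂ) 1, τ₀ + t • w ∈ Metric.ball τ₀ ρ := by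
    intro t ht
    rw [Metric.mem_ball, dist_eq_norm, add_sub_cancel_left, norm_smul]
    have := mem_ball_zero_iff.1 ht
    nlinarith [norm_nonneg w, norm_nonneg t]
  have := hsch (fun t => Φ (τ₀ + t • w) x) ?_ ?_ (by simpa using hxN') ((δ / 2 : ℝ) : ℂ)
    (by rw [Complex.norm_real, Real.norm_eq_abs, abs_of_pos (by positivity)]; linarith)
  · rw [hw, smul_inv_smul₀ (by exact_mod_cast (half_pos hδ).ne'), add_sub_cancel] at this
    exact this
  · intro t ht
    have h1 : MDifferentiableAt 𝓘(ℂ, V) 𝓘(ℂ) (fun τ => Φ τ x) (τ₀ + t • w) :=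
      (h x).mdifferentiableAt
        (Metric.isOpen_ball.mem_nhds (Metric.ball_subset_ball hρr (hmaps t ht)))
    have h2 : MDifferentiableAt 𝓘(ℂ) 𝓘(ℂ, V) (fun t : ℂ => τ₀ + t • w) t :=
      mdifferentiableAt_iff_differentiableAt.2 (by fun_prop)
    exact (h1.comp t h2).mdifferentiableWithinAt
  · intro t ht hmem
    obtain ⟨y, hy, hyG'⟩ := mem_iUnion₂.1 hmem
    exact hom y (hSmem y hy) _ (Metric.ball_subset_ball (hρS y hy) (hmaps t ht)) x (hxB y hy) hyG'

variable {E : Type*} [NormedAddCommGroup E] [NormedSpace ℂ E]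
  {M : Type*} [TopologicalSpace M] [ChartedSpace E M] [IsManifold 𝓘(ℂ, E) 1 M]

theorem continuous_uncurry_of_mdifferentiable {φ : M → X ≃ₜ X}
    (h : ∀ x, MDifferentiable 𝓘(ℂ, E) 𝓘(ℂ) (fun t => φ t x)) :
    Continuous fun q : M × X => φ q.1 q.2 := by
  rw [continuous_iff_continuousAt]
  rintro ⟨s, x₀⟩
  set e := chartAt E s
  have hs : s ∈ e.source := mem_chart_source E s
  obtain ⟨r, hr, hrt⟩ := Metric.isOpen_iff.1 e.open_target (e s) (e.map_source hs)
  have h1 := continuousAt_uncurry_of_mdifferentiableOn (Φ := fun τ => φ (e.symm τ)) (τ₀ := e s) hr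
    (fun x τ hτ => ((h x (e.symm τ)).comp τ
      (mdifferentiableAt_atlas_symm (chart_mem_atlas E s) (hrt hτ))).mdifferentiableWithinAt) x₀
  have h2 : ContinuousAt (fun q : M × X => (e q.1, q.2)) (s, x₀) :=
    ((e.continuousAt hs).comp continuousAt_fst).prodMk continuousAt_snd
  refine (ContinuousAt.comp (f := fun q : M × X => (e q.1, q.2)) h1 h2).congr ?_
  have h3 : ∀ᶠ q : M × X in 𝓝 (s, x₀), q.1 ∈ e.source :=
    continuousAt_fst.eventually (e.open_source.mem_nhds hs)
  filter_upwards [h3] with q hq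
  simp [e.left_inv hq]

omit [ChartedSpace ℂ X] [IsManifold 𝓘(ℂ) 1 X] in
/-- The inverses of a jointly continuous family of homeomorphisms of a compact space are jointly
continuous. -/
theorem continuous_uncurry_symm {T : Type*} [TopologicalSpace T] {φ : T → X ≃ₜ X}
    (h : Continuous fun q : T × X => φ q.1 q.2) : Continuous fun q : T × X => (φ q.1).symm q.2 := by
  rw [continuous_iff_continuousAt]
  rintro ⟨s, y⟩
  -- By compactness the preimages converge along an ultrafilter; joint continuity of `φ` identifies
  -- the limit as the preimage of `y`.
  refine (tendsto_iff_ultrafilter _ _ _).2 fun g hg => ?_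
  obtain ⟨x, -, hx⟩ := isCompact_univ.ultrafilter_le_nhds (g.map fun q : T × X => (φ q.1).symm q.2)
    (by simp)
  have hx' : Tendsto (fun q : T × X => (φ q.1).symm q.2) g (𝓝 x) := hx
  have hg' : Tendsto (fun q : T × X => q) g (𝓝 (s, y)) := hg
  have h1 : Tendsto (fun q : T × X => (q.1, (φ q.1).symm q.2)) g (𝓝 (s, x)) :=
    ((continuous_fst.tendsto _).comp hg').prodMk_nhds hx'
  have h2 := (h.tendsto (s, x)).comp h1
  have h3 : Tendsto (fun q : T × X => q.2) g (𝓝 y) := (continuous_snd.tendsto _).comp hg'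
  have h4 : φ s x = y := tendsto_nhds_unique h2 (h3.congr fun q => by simp)
  have : (φ s).symm y = x := by rw [← h4, Homeomorph.symm_apply_apply]
  simpa [this] using hx'

end JointContinuity

/-! ### Holomorphy of continuous solutions of implicit equations -/

section ImplicitDifferentiability

variable {E : Type*} [NormedAddCommGroup E] [NormedSpace ℂ E]

omit [NormedSpace ℂ E] in
/-- If `F τ z` is jointly continuous and holomorphic in `z`, then the increments of `F τ` are
uniformly close to those of the linearization of `F τ₁` at `z₁`. -/
theorem eventually_norm_sub_sub_le {F : E → ℂ → ℂ} {τ₁ : E} {z₁ : ℂ}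
    (hcont : ∀ᶠ q : E × ℂ in 𝓝 (τ₁, z₁), ContinuousAt (fun q : E × ℂ => F q.1 q.2) q)
    (hol : ∀ᶠ q : E × ℂ in 𝓝 (τ₁, z₁), DifferentiableAt ℂ (F q.1) q.2)
    {ε : ℝ} (hε : 0 < ε) :
    ∀ᶠ q : E × ℂ × ℂ in 𝓝 (τ₁, z₁, z₁),
      ‖F q.1 q.2.1 - F q.1 q.2.2 - deriv (F τ₁) z₁ * (q.2.1 - q.2.2)‖ ≤ ε * ‖q.2.1 - q.2.2‖ := by
  set D := deriv (F τ₁) z₁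
  have hd₁ : HasDerivAt (F τ₁) D z₁ := hol.self_of_nhds.hasDerivAt
  have h1 : ∀ᶠ z in 𝓝 z₁, ‖F τ₁ z - F τ₁ z₁ - (z - z₁) • D‖ ≤ ε / 8 * ‖z - z₁‖ :=
    (hasDerivAt_iff_isLittleO.1 hd₁).bound (by positivity)
  obtain ⟨pa, hpa, pb, hpb, hab⟩ := eventually_prod_iff.1 ((nhds_prod_eq (x := τ₁) (y := z₁)) ▸ hcont.and hol)
  obtain ⟨ρ, hρ, hρ'⟩ := Metric.nhds_basis_closedBall.eventually_iff.1 (h1.and hpb)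
  have hη : 0 < ε / 8 * ρ := by positivity
  have huni : ∀ᶠ τ in 𝓝 τ₁, ∀ z ∈ Metric.closedBall z₁ ρ, ‖F τ z - F τ₁ z‖ ≤ ε / 8 * ρ := by
    refine (isCompact_closedBall z₁ ρ).eventually_forall_of_forall_eventually fun z hz => ?_
    have hc : ContinuousAt (fun q : E × ℂ => F q.1 q.2) (τ₁, z) := (hab hpa.self_of_nhds (hρ' hz).2).1
    have hc2 : ContinuousAt (fun q : E × ℂ => F τ₁ q.2) (τ₁, z) :=
      ContinuousAt.comp (f := fun q : E × ℂ => (τ₁, q.2)) (g := fun q : E × ℂ => F q.1 q.2) hc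
        (continuousAt_const.prodMk continuousAt_snd)
    have := (hc.sub hc2).norm
    refine (this.eventually (gt_mem_nhds (by simpa using hη))).mono fun q hq => hq.le
  have hz : ∀ᶠ z in 𝓝 z₁, z ∈ Metric.ball z₁ (ρ / 2) := Metric.ball_mem_nhds _ (by positivity)
  filter_upwards [(huni.and hpa).prod_nhds (hz.prod_nhds hz)] with ⟨τ, x, y⟩ ⟨⟨hτ, hτa⟩, hx, hy⟩
  simp only at hτ hτa hx hy ⊢
  -- `H` is within `ε ρ / 4` of a constant on the large disc. Cauchy's estimate on discs of radius
  -- `ρ / 2` gives `‖H'‖ ≤ ε`, and the mean value inequality concludes.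
  set H : ℂ → ℂ := fun z => F τ z - D * z
  have hdiff : ∀ z ∈ Metric.closedBall z₁ ρ, DifferentiableAt ℂ H z := fun z hz =>
    (hab hτa (hρ' hz).2).2.sub (by fun_prop)
  have hbd : ∀ z ∈ Metric.closedBall z₁ ρ, ‖H z - (F τ₁ z₁ - D * z₁)‖ ≤ ε / 4 * ρ := by
    intro z hz
    have e1 := hτ z hz
    have e2 := (hρ' hz).1
    have e3 : ‖z - z₁‖ ≤ ρ := by simpa [dist_eq_norm] using hz
    calc ‖H z - (F τ₁ z₁ - D * z₁)‖
        = ‖(F τ z - F τ₁ z) + (F τ₁ z - F τ₁ z₁ - (z - z₁) • D)‖ := by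
          simp only [H, smul_eq_mul]; congr 1; ring
      _ ≤ ε / 8 * ρ + ε / 8 * ρ := (norm_add_le _ _).trans (add_le_add e1 (e2.trans (by gcongr)))
      _ = ε / 4 * ρ := by ring
  have hsub : ∀ w ∈ Metric.ball z₁ (ρ / 2), Metric.ball w (ρ / 2) ⊆ Metric.closedBall z₁ ρ := by
    intro w hw
    refine (Metric.ball_subset_ball' ?_).trans Metric.ball_subset_closedBall
    have := Metric.mem_ball.1 hw
    linarith
  have hderiv : ∀ w ∈ Metric.ball z₁ (ρ / 2), ‖deriv H w‖ ≤ ε := by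
    intro w hw
    have hwm := hsub w hw (Metric.mem_ball_self (by positivity))
    have := Complex.norm_deriv_le_div_of_mapsTo_ball (f := H) (c := w) (R₁ := ρ / 2) (R₂ := ε / 2 * ρ)
      (fun z hz => (hdiff z (hsub w hw hz)).differentiableWithinAt) ?_ (by positivity)
    · refine this.trans_eq ?_
      field_simp
    · intro z hz
      rw [Metric.mem_closedBall]
      refine (dist_triangle_right _ _ (F τ₁ z₁ - D * z₁)).trans ?_
      have e1 := hbd z (hsub w hw hz)
      have e2 := hbd w hwm
      rw [dist_eq_norm, dist_eq_norm]
      linarith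
  have hmv := (convex_ball z₁ (ρ / 2)).norm_image_sub_le_of_norm_deriv_le (f := H) (C := ε)
    (fun w hw => hdiff w (hsub w hw (Metric.mem_ball_self (by positivity)))) hderiv hy hx
  refine (congrArg norm ?_).trans_le hmv
  simp only [H]
  ring

/-- A continuous solution `a` of an implicit equation is differentiable if the right hand side is,
provided the equation has some differentiable solution `b` for a differentiable right hand side. -/
theorem differentiableAt_of_implicit {F : E → ℂ → ℂ} {τ₁ : E} {z₁ : ℂ}
    (hcont : ∀ᶠ q : E × ℂ in 𝓝 (τ₁, z₁), ContinuousAt (fun q : E × ℂ => F q.1 q.2) q)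
    (hol : ∀ᶠ q : E × ℂ in 𝓝 (τ₁, z₁), DifferentiableAt ℂ (F q.1) q.2)
    (hD : deriv (F τ₁) z₁ ≠ 0) {a b : E → ℂ} (ha : ContinuousAt a τ₁) (hb : DifferentiableAt ℂ b τ₁)
    (ha₁ : a τ₁ = z₁) (hb₁ : b τ₁ = z₁) (hFa : DifferentiableAt ℂ (fun τ => F τ (a τ)) τ₁)
    (hFb : DifferentiableAt ℂ (fun τ => F τ (b τ)) τ₁) : DifferentiableAt ℂ a τ₁ := by
  set D := deriv (F τ₁) z₁
  set d : E → ℂ := fun τ => a τ - b τ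
  set g : E → ℂ := fun τ => F τ (a τ) - F τ (b τ)
  have hg : DifferentiableAt ℂ g τ₁ := hFa.sub hFb
  have hg₁ : g τ₁ = 0 := by simp [g, ha₁, hb₁]
  have hd₁ : d τ₁ = 0 := by simp [d, ha₁, hb₁]
  have htend : Tendsto (fun τ => (τ, a τ, b τ)) (𝓝 τ₁) (𝓝 (τ₁, z₁, z₁)) := by
    have h1 : Tendsto a (𝓝 τ₁) (𝓝 z₁) := ha₁ ▸ ha
    have h2 : Tendsto b (𝓝 τ₁) (𝓝 z₁) := hb₁ ▸ hb.continuousAt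
    exact tendsto_id.prodMk_nhds (h1.prodMk_nhds h2)
  -- From `g = D d + o(d)` with `D ≠ 0` follows `d = O(g) = O(τ - τ₁)`. So `g - D d` is `o(τ - τ₁)`,
  -- and `d` is differentiable because `g` is; differentiability of `F` in the parameter is never
  -- needed.
  have hsmall : (fun τ => g τ - D * d τ) =o[𝓝 τ₁] d := by
    refine Asymptotics.isLittleO_iff.2 fun ε hε => ?_
    exact htend.eventually (eventually_norm_sub_sub_le hcont hol hε)
  have hdO : d =O[𝓝 τ₁] fun τ => τ - τ₁ := by
    have h1 : (fun τ => D * d τ) =O[𝓝 τ₁] fun τ => g τ := by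
      have h2 : (fun τ => g τ - D * d τ) =o[𝓝 τ₁] fun τ => D * d τ :=
        hsmall.trans_isBigO (Asymptotics.isBigO_self_const_mul hD d _)
      have := h2.right_isBigO_add
      simpa using this
    have h3 : g =O[𝓝 τ₁] fun τ => τ - τ₁ := by
      simpa [hg₁] using hg.isBigO_sub
    exact (Asymptotics.isBigO_self_const_mul hD d _).trans (h1.trans h3)
  have hz : HasFDerivAt (fun τ => g τ - D * d τ) (0 : E →L[ℂ] ℂ) τ₁ := by
    refine HasFDerivAt.of_isLittleO ?_
    simpa [hg₁, hd₁] using hsmall.trans_isBigO hdO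
  have hDd : DifferentiableAt ℂ (fun τ => D * d τ) τ₁ := by
    have := hg.sub hz.differentiableAt
    refine this.congr_of_eventuallyEq (Eventually.of_forall fun τ => ?_)
    simp
  have hdd : DifferentiableAt ℂ d τ₁ := by
    have := hDd.const_mul D⁻¹
    refine this.congr_of_eventuallyEq (Eventually.of_forall fun τ => ?_)
    simp [inv_mul_cancel_left₀ hD]
  have := hdd.add hb
  refine this.congr_of_eventuallyEq (Eventually.of_forall fun τ => ?_)
  simp [d]

variable {M : Type*} [TopologicalSpace M] [ChartedSpace E M] [IsManifold 𝓘(ℂ, E) 1 M]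
  {X : Type*} [TopologicalSpace X] [ChartedSpace ℂ X]

theorem mfderiv_eq_fderiv_chart {f : X → X} {x : X} (hf : MDifferentiableAt 𝓘(ℂ) 𝓘(ℂ) f x) :
    mfderiv 𝓘(ℂ) 𝓘(ℂ) f x = fderiv ℂ (fun z => chartAt ℂ (f x) (f ((chartAt ℂ x).symm z)))
      (chartAt ℂ x x) := by
  rw [hf.mfderiv, ModelWithCorners.range_eq_univ, fderivWithin_univ]
  rfl

theorem deriv_chart_ne_zero {f : X → X} {x : X} (hf : MDifferentiableAt 𝓘(ℂ) 𝓘(ℂ) f x)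
    (h : mfderiv 𝓘(ℂ) 𝓘(ℂ) f x ≠ 0) :
    deriv (fun z => chartAt ℂ (f x) (f ((chartAt ℂ x).symm z))) (chartAt ℂ x x) ≠ 0 := by
  intro h0
  apply h
  rw [mfderiv_eq_fderiv_chart hf]
  exact ContinuousLinearMap.ext_ring (R₁ := ℂ) (fderiv_apply_one_eq_deriv.trans h0)

variable [IsManifold 𝓘(ℂ) 1 X]

theorem mdifferentiableAt_of_implicit {F : M → X → X} {s : M} {x₁ : X}
    (hcont : ∀ᶠ q : M × X in 𝓝 (s, x₁), ContinuousAt (fun q : M × X => F q.1 q.2) q)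
    (hol : ∀ᶠ q : M × X in 𝓝 (s, x₁), MDifferentiableAt 𝓘(ℂ) 𝓘(ℂ) (F q.1) q.2)
    (hD : mfderiv 𝓘(ℂ) 𝓘(ℂ) (F s) x₁ ≠ 0) {a b : M → X} (ha : ContinuousAt a s)
    (hb : MDifferentiableAt 𝓘(ℂ, E) 𝓘(ℂ) b s) (ha₁ : a s = x₁) (hb₁ : b s = x₁)
    (hFa : MDifferentiableAt 𝓘(ℂ, E) 𝓘(ℂ) (fun t => F t (a t)) s)
    (hFb : MDifferentiableAt 𝓘(ℂ, E) 𝓘(ℂ) (fun t => F t (b t)) s) :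
    MDifferentiableAt 𝓘(ℂ, E) 𝓘(ℂ) a s := by
  set e := chartAt E s
  set c := chartAt ℂ x₁
  set c' := chartAt ℂ (F s x₁)
  have hs : s ∈ e.source := mem_chart_source E s
  have hx : x₁ ∈ c.source := mem_chart_source ℂ x₁
  have hy : F s x₁ ∈ c'.source := mem_chart_source ℂ _
  have hes : e.symm (e s) = s := e.left_inv hs
  have hcx : c.symm (c x₁) = x₁ := c.left_inv hx
  have hse : ContinuousAt e.symm (e s) := e.continuousAt_symm (e.map_source hs)
  have hme : MDifferentiableAt 𝓘(ℂ, E) 𝓘(ℂ, E) e.symm (e s) :=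
    mdifferentiableAt_atlas_symm (chart_mem_atlas E s) (e.map_source hs)
  have hpair : Tendsto (fun q : E × ℂ => (e.symm q.1, c.symm q.2)) (𝓝 (e s, c x₁)) (𝓝 (s, x₁)) := by
    have h1 : ContinuousAt (fun q : E × ℂ => e.symm q.1) (e s, c x₁) :=
      ContinuousAt.comp (f := fun q : E × ℂ => q.1) hse continuousAt_fst
    have h2 : ContinuousAt (fun q : E × ℂ => c.symm q.2) (e s, c x₁) :=
      ContinuousAt.comp (f := fun q : E × ℂ => q.2) (c.continuousAt_symm (c.map_source hx)) continuousAt_snd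
    have := h1.prodMk h2
    simpa only [ContinuousAt, hes, hcx] using this
  have hFs : ∀ᶠ q : M × X in 𝓝 (s, x₁), F q.1 q.2 ∈ c'.source :=
    hcont.self_of_nhds.eventually (c'.open_source.mem_nhds hy)
  have htgt : ∀ᶠ q : E × ℂ in 𝓝 (e s, c x₁), q.1 ∈ e.target ∧ q.2 ∈ c.target :=
    prod_mem_nhds (e.open_target.mem_nhds (e.map_source hs))
      (c.open_target.mem_nhds (c.map_source hx))
  have comp_chart : ∀ g : M → X, MDifferentiableAt 𝓘(ℂ, E) 𝓘(ℂ) g s → ∀ k : OpenPartialHomeomorph X ℂ,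
      k ∈ atlas ℂ X → g s ∈ k.source → DifferentiableAt ℂ (fun τ => k (g (e.symm τ))) (e s) := by
    intro g hg k hk hgs
    rw [← mdifferentiableAt_iff_differentiableAt]
    have h1 : MDifferentiableAt 𝓘(ℂ, E) 𝓘(ℂ) g (e.symm (e s)) := by rwa [hes]
    have h2 : MDifferentiableAt 𝓘(ℂ) 𝓘(ℂ) k (g (e.symm (e s))) := by
      rw [hes]; exact mdifferentiableAt_atlas hk hgs
    exact h2.comp (e s) (h1.comp (e s) hme)
  have hacont : ContinuousAt (fun τ => a (e.symm τ)) (e s) :=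
    ContinuousAt.comp (f := e.symm) (by rwa [hes]) hse
  have hanear : ∀ᶠ t in 𝓝 s, a t ∈ c.source := ha.eventually (c.open_source.mem_nhds (by rwa [ha₁]))
  have hbnear : ∀ᶠ t in 𝓝 s, b t ∈ c.source :=
    hb.continuousAt.eventually (c.open_source.mem_nhds (by rwa [hb₁]))
  have hse' : Tendsto e.symm (𝓝 (e s)) (𝓝 s) := by simpa only [ContinuousAt, hes] using hse
  have main : DifferentiableAt ℂ (fun τ => c (a (e.symm τ))) (e s) := by
    refine differentiableAt_of_implicit (F := fun τ z => c' (F (e.symm τ) (c.symm z)))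
      (z₁ := c x₁) (b := fun τ => c (b (e.symm τ))) ?_ ?_ ?_ ?_ ?_ (by rw [hes, ha₁])
      (by rw [hes, hb₁]) ?_ ?_
    · filter_upwards [hpair.eventually (hcont.and hFs), htgt] with q ⟨h1, h2⟩ ⟨h3, h4⟩
      have h5 : ContinuousAt (fun q : E × ℂ => (e.symm q.1, c.symm q.2)) q :=
        (ContinuousAt.comp (f := fun q : E × ℂ => q.1) (e.continuousAt_symm h3) continuousAt_fst).prodMk
          (ContinuousAt.comp (f := fun q : E × ℂ => q.2) (c.continuousAt_symm h4) continuousAt_snd)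
      exact ContinuousAt.comp (f := fun q : E × ℂ => F (e.symm q.1) (c.symm q.2))
        (c'.continuousAt h2) (ContinuousAt.comp (f := fun q : E × ℂ => (e.symm q.1, c.symm q.2))
          (g := fun q : M × X => F q.1 q.2) h1 h5)
    · filter_upwards [hpair.eventually (hol.and hFs), htgt] with q ⟨h1, h2⟩ ⟨h3, h4⟩
      rw [← mdifferentiableAt_iff_differentiableAt]
      exact (mdifferentiableAt_atlas (chart_mem_atlas ℂ _) h2).comp q.2
        (h1.comp q.2 (mdifferentiableAt_atlas_symm (chart_mem_atlas ℂ _) h4))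
    · simp only [hes]
      exact deriv_chart_ne_zero hol.self_of_nhds hD
    · refine ContinuousAt.comp (f := fun τ => a (e.symm τ)) (c.continuousAt ?_) hacont
      rwa [hes, ha₁]
    · exact comp_chart b hb c (chart_mem_atlas ℂ _) (by rwa [hb₁])
    · refine (comp_chart _ hFa c' (chart_mem_atlas ℂ _) (by rwa [ha₁])).congr_of_eventuallyEq ?_
      filter_upwards [hse'.eventually hanear] with τ hτ
      simp only [c.left_inv hτ]
    · refine (comp_chart _ hFb c' (chart_mem_atlas ℂ _) (by rwa [hb₁])).congr_of_eventuallyEq ?_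
      filter_upwards [hse'.eventually hbnear] with τ hτ
      simp only [c.left_inv hτ]
  have h1 : MDifferentiableAt 𝓘(ℂ, E) 𝓘(ℂ) (fun τ => c (a (e.symm τ))) (e s) :=
    mdifferentiableAt_iff_differentiableAt.2 main
  have h2 : MDifferentiableAt 𝓘(ℂ) 𝓘(ℂ) c.symm (c (a (e.symm (e s)))) :=
    mdifferentiableAt_atlas_symm (chart_mem_atlas ℂ _) (by rw [hes, ha₁]; exact c.map_source hx)
  have h3 : MDifferentiableAt 𝓘(ℂ, E) 𝓘(ℂ, E) e s := mdifferentiableAt_atlas (chart_mem_atlas E s) hs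
  refine ((h2.comp (e s) h1).comp s h3).congr_of_eventuallyEq ?_
  filter_upwards [hanear, e.open_source.mem_nhds hs] with t ht1 ht2
  simp [e.left_inv ht2, c.left_inv ht1]

end ImplicitDifferentiability

/-! ### Local injectivity, openness and isolated preimages of holomorphic maps -/

section LocalMappingProperties

/-- `f` is injective near `w`. -/
def LocInjAt {X Y : Type*} [TopologicalSpace X] (f : X → Y) (w : X) : Prop :=
  ∃ B ∈ 𝓝 w, InjOn f B

theorem isOpen_setOf_locInjAt {X Y : Type*} [TopologicalSpace X] (f : X → Y) :
    IsOpen {w | LocInjAt f w} := by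
  rw [isOpen_iff_mem_nhds]
  rintro w ⟨B, hB, hinj⟩
  filter_upwards [eventually_mem_nhds_iff.2 hB] with v hv using ⟨B, hv, hinj⟩

variable {X : Type*} [TopologicalSpace X] [ChartedSpace ℂ X] [IsManifold 𝓘(ℂ) 1 X] {f : X → X}
  {W : Set X}

theorem analyticAt_chart (hW : IsOpen W) (hf : MDifferentiableOn 𝓘(ℂ) 𝓘(ℂ) f W) {w : X}
    (hw : w ∈ W) : AnalyticAt ℂ (fun z => chartAt ℂ (f w) (f ((chartAt ℂ w).symm z)))
      (chartAt ℂ w w) := by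
  rw [Complex.analyticAt_iff_eventually_differentiableAt]
  set c := chartAt ℂ w
  set c' := chartAt ℂ (f w)
  have hws : w ∈ c.source := mem_chart_source ℂ w
  have hfd : ∀ᶠ v in 𝓝 w, MDifferentiableAt 𝓘(ℂ) 𝓘(ℂ) f v ∧ f v ∈ c'.source := by
    have h1 : ContinuousAt f w := (hf.continuousOn.continuousAt (hW.mem_nhds hw))
    filter_upwards [hW.mem_nhds hw, h1.eventually (c'.open_source.mem_nhds (mem_chart_source ℂ _))]
      with v hv hv' using ⟨hf.mdifferentiableAt (hW.mem_nhds hv), hv'⟩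
  have hc : Tendsto c.symm (𝓝 (c w)) (𝓝 w) := by
    simpa [ContinuousAt, c.left_inv hws] using c.continuousAt_symm (c.map_source hws)
  filter_upwards [hc.eventually hfd, c.open_target.mem_nhds (c.map_source hws)] with z ⟨h1, h2⟩ h3
  rw [← mdifferentiableAt_iff_differentiableAt]
  exact (mdifferentiableAt_atlas (chart_mem_atlas ℂ _) h2).comp z
    (h1.comp z (mdifferentiableAt_atlas_symm (chart_mem_atlas ℂ _) h3))

omit [IsManifold 𝓘(ℂ) 1 X] in
theorem eventually_mem_chart_source (hW : IsOpen W) (hf : MDifferentiableOn 𝓘(ℂ) 𝓘(ℂ) f W) {w : X}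
    (hw : w ∈ W) : ∀ᶠ v in 𝓝 w, v ∈ (chartAt ℂ w).source ∧ f v ∈ (chartAt ℂ (f w)).source := by
  have h1 : ContinuousAt f w := (hf.continuousOn.continuousAt (hW.mem_nhds hw))
  filter_upwards [(chartAt ℂ w).open_source.mem_nhds (mem_chart_source ℂ w),
    h1.eventually ((chartAt ℂ (f w)).open_source.mem_nhds (mem_chart_source ℂ _))] with v h h'
    using ⟨h, h'⟩

theorem locInjAt_of_mfderiv_ne_zero (hW : IsOpen W) (hf : MDifferentiableOn 𝓘(ℂ) 𝓘(ℂ) f W) {w : X}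
    (hw : w ∈ W) (h : mfderiv 𝓘(ℂ) 𝓘(ℂ) f w ≠ 0) : LocInjAt f w := by
  have hd := deriv_chart_ne_zero (hf.mdifferentiableAt (hW.mem_nhds hw)) h
  have ha := (analyticAt_chart hW hf hw).hasStrictDerivAt
  set c := chartAt ℂ w
  set c' := chartAt ℂ (f w)
  have hws : w ∈ c.source := mem_chart_source ℂ w
  set q := (ha.hasStrictFDerivAt_equiv hd).toOpenPartialHomeomorph
  have hq : q.source ∈ 𝓝 (c w) :=
    q.open_source.mem_nhds (ha.hasStrictFDerivAt_equiv hd).mem_toOpenPartialHomeomorph_source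
  refine ⟨_, inter_mem ((c.continuousAt hws).preimage_mem_nhds hq) (c.open_source.mem_nhds hws), ?_⟩
  rintro v ⟨hv, hvs⟩ v' ⟨hv', hvs'⟩ hvv
  refine c.injOn hvs hvs' (q.injOn hv hv' ?_)
  change c' (f (c.symm (c v))) = c' (f (c.symm (c v')))
  rw [c.left_inv hvs, c.left_inv hvs', hvv]

theorem eventually_eq_or_nhds_le_map (hW : IsOpen W) (hf : MDifferentiableOn 𝓘(ℂ) 𝓘(ℂ) f W) {w : X}
    (hw : w ∈ W) : (∀ᶠ v in 𝓝 w, f v = f w) ∨ 𝓝 (f w) ≤ map f (𝓝 w) := by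
  have hn := eventually_mem_chart_source hW hf hw
  set c := chartAt ℂ w
  set c' := chartAt ℂ (f w)
  have hws : w ∈ c.source := mem_chart_source ℂ w
  rcases (analyticAt_chart hW hf hw).eventually_constant_or_nhds_le_map_nhds with h | h
  · left
    filter_upwards [(c.continuousAt hws).eventually h, hn] with v hv ⟨hv1, hv2⟩
    rw [c.left_inv hv1, c.left_inv hws] at hv
    exact c'.injOn hv2 (mem_chart_source ℂ _) hv
  · right
    intro N hN
    rw [mem_map] at hN
    have h1 : (fun z => c' (f (c.symm z))) '' (c.target ∩ c.symm ⁻¹' (f ⁻¹' N ∩ f ⁻¹' c'.source)) ∈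
        𝓝 (c' (f (c.symm (c w)))) := by
      refine h (mem_map.2 (mem_of_superset ?_ (subset_preimage_image _ _)))
      refine inter_mem (c.open_target.mem_nhds (c.map_source hws)) ?_
      refine (c.continuousAt_symm (c.map_source hws)).preimage_mem_nhds ?_
      rw [c.left_inv hws]
      exact inter_mem hN (hn.mono fun v hv => hv.2)
    rw [c.left_inv hws] at h1
    filter_upwards [(c'.continuousAt (mem_chart_source ℂ (f w))).preimage_mem_nhds h1,
      c'.open_source.mem_nhds (mem_chart_source ℂ (f w))] with y hy hys
    obtain ⟨z, ⟨-, hz1, hz2⟩, hz⟩ := hy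
    rw [← c'.injOn hz2 hys hz]
    exact hz1

theorem eventually_eq_or_eventually_ne (hW : IsOpen W) (hf : MDifferentiableOn 𝓘(ℂ) 𝓘(ℂ) f W) {w : X}
    (hw : w ∈ W) : (∀ᶠ v in 𝓝 w, f v = f w) ∨ ∀ᶠ v in 𝓝[≠] w, f v ≠ f w := by
  have hn := eventually_mem_chart_source hW hf hw
  set c := chartAt ℂ w
  set c' := chartAt ℂ (f w)
  have hws : w ∈ c.source := mem_chart_source ℂ w
  rcases ((analyticAt_chart hW hf hw).eventually_eq_or_eventually_ne
    (analyticAt_const (v := c' (f w)))) with h | h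
  · left
    filter_upwards [(c.continuousAt hws).eventually h, hn] with v hv ⟨hv1, hv2⟩
    rw [c.left_inv hv1] at hv
    exact c'.injOn hv2 (mem_chart_source ℂ _) hv
  · right
    rw [eventually_nhdsWithin_iff] at h ⊢
    filter_upwards [(c.continuousAt hws).eventually h, hn] with v hv ⟨hv1, hv2⟩ hne heq
    refine hv (fun e => hne (c.injOn hv1 hws e)) ?_
    change c' (f (c.symm (c v))) = c' (f w)
    rw [c.left_inv hv1, heq]

/-- Identity theorem: inside `W`, the points near which `f` is identically `f w` and the remaining
points both form open sets, so one point of the first kind would make `f` constant on its component.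
-/
theorem eventually_ne_of_nonconstant [T2Space X] (hW : IsOpen W)
    (hf : MDifferentiableOn 𝓘(ℂ) 𝓘(ℂ) f W)
    (hnc : ∀ x ∈ W, ∃ y ∈ connectedComponentIn W x, f y ≠ f x) {w : X} (hw : w ∈ W) :
    ∀ᶠ v in 𝓝[≠] w, f v ≠ f w := by
  refine (eventually_eq_or_eventually_ne hW hf hw).resolve_left fun hconst => ?_
  obtain ⟨y, hy, hne⟩ := hnc w hw
  set A : Set X := {z | ∀ᶠ v in 𝓝 z, f v = f w}
  set A' : Set X := {z | z ∈ W ∧ ¬ ∀ᶠ v in 𝓝 z, f v = f w}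
  have hA : IsOpen A := isOpen_iff_mem_nhds.2 fun z hz => eventually_eventually_nhds.2 hz
  have hA' : IsOpen A' := by
    refine isOpen_iff_mem_nhds.2 ?_
    rintro z ⟨hzW, hz⟩
    have hpunct : ∀ᶠ v in 𝓝[≠] z, f v ≠ f w := by
      by_cases hfz : f z = f w
      · rw [← hfz] at hz ⊢
        exact (eventually_eq_or_eventually_ne hW hf hzW).resolve_left hz
      · exact ((hf.continuousOn.continuousAt (hW.mem_nhds hzW)).eventually_ne hfz).filter_mono
          nhdsWithin_le_nhds
    rw [eventually_nhdsWithin_iff] at hpunct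
    filter_upwards [hW.mem_nhds hzW, hpunct] with v hv hv'
    refine ⟨hv, fun h => ?_⟩
    rcases eq_or_ne v z with rfl | hvz
    · exact hz h
    · exact hv' hvz h.self_of_nhds
  have hsub := (isPreconnected_connectedComponentIn (x := w) (F := W)).subset_left_of_subset_union
    hA hA' (Set.disjoint_left.2 fun z hz hz' => hz'.2 hz)
    (fun z hz => by
      by_cases h : z ∈ A
      · exact Or.inl h
      · exact Or.inr ⟨connectedComponentIn_subset W w hz, h⟩)
    ⟨w, mem_connectedComponentIn hw, hconst⟩
  exact hne (hsub hy).self_of_nhds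

omit [IsManifold 𝓘(ℂ) 1 X] in
theorem not_eventually_eq_of_locInjAt {w : X} (h : LocInjAt f w) : ¬ ∀ᶠ v in 𝓝 w, f v = f w := by
  intro hev
  obtain ⟨B, hB, hinj⟩ := h
  obtain ⟨O, hO, hOo, hwO⟩ := mem_nhds_iff.1 (inter_mem hB hev)
  obtain ⟨v, hv, hne⟩ := exists_ne_of_isOpen hOo ⟨w, hwO⟩ w
  exact hne (hinj (hO hv).1 (mem_of_mem_nhds hB) (hO hv).2)

/-- A holomorphic map is a local homeomorphism on the set where it is locally injective. -/
theorem isLocalHomeomorph_restrict_locInjAt (hW : IsOpen W) (hf : MDifferentiableOn 𝓘(ℂ) 𝓘(ℂ) f W) :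
    IsLocalHomeomorph fun w : {w | w ∈ W ∧ LocInjAt f w} => f w := by
  set W' := {w | w ∈ W ∧ LocInjAt f w}
  have hW' : IsOpen W' := hW.inter (isOpen_setOf_locInjAt f)
  have hcont : Continuous fun w : W' => f w := by
    have : ContinuousOn f W' := hf.continuousOn.mono fun w hw => hw.1
    exact this.domRestrict
  have hopen : IsOpenMap fun w : W' => f w := by
    rw [isOpenMap_iff_nhds_le]
    rintro ⟨w, hw⟩
    have h1 := (eventually_eq_or_nhds_le_map hW hf hw.1).resolve_left
      (not_eventually_eq_of_locInjAt hw.2)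
    refine h1.trans_eq ?_
    rw [← map_nhds_subtype_coe_eq_nhds hw (hW'.mem_nhds hw), map_map]
    rfl
  rw [isLocalHomeomorph_iff_isOpenEmbedding_restrict]
  rintro ⟨w, hwW, B, hB, hinj⟩
  obtain ⟨O, hOB, hO, hwO⟩ := mem_nhds_iff.1 hB
  refine ⟨Subtype.val ⁻¹' O, (hO.preimage continuous_subtype_val).mem_nhds hwO, ?_⟩
  refine .of_continuous_injective_isOpenMap (hcont.comp continuous_subtype_val) ?_
    (hopen.comp (hO.preimage continuous_subtype_val).isOpenMap_subtype_val)
  rintro ⟨⟨v, hv⟩, hvO⟩ ⟨⟨v', hv'⟩, hvO'⟩ h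
  have := hinj (hOB hvO) (hOB hvO') h
  subst this
  rfl

end LocalMappingProperties

/-! ### Lifting through a holomorphic map away from its singular values -/

section PathLifting

variable {X Y : Type*} [TopologicalSpace X] [TopologicalSpace Y] {p : Y → X} {c : ℝ → X} {y₀ : Y}

/-- `Γ` is a continuous lift of `c` through `p` on the set `s`, starting at `y₀`. -/
def IsLiftOn (p : Y → X) (c : ℝ → X) (y₀ : Y) (s : Set ℝ) (Γ : ℝ → Y) : Prop :=
  ContinuousOn Γ s ∧ (∀ σ ∈ s, p (Γ σ) = c σ) ∧ Γ 0 = y₀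

omit [TopologicalSpace X] in
theorem IsLiftOn.mono {s t : Set ℝ} {Γ : ℝ → Y} (h : IsLiftOn p c y₀ t Γ) (hst : s ⊆ t) :
    IsLiftOn p c y₀ s Γ :=
  ⟨h.1.mono hst, fun σ hσ => h.2.1 σ (hst hσ), h.2.2⟩

theorem IsLiftOn.extend (hc : Continuous c) {a b : ℝ} (ha : 0 ≤ a) (hab : a ≤ b) {Γ : ℝ → Y}
    (h : IsLiftOn p c y₀ (Icc 0 a) Γ) {q : OpenPartialHomeomorph Y X} (hq : p = q)
    (hqa : Γ a ∈ q.source) (hqc : ∀ σ ∈ Icc a b, c σ ∈ q.target) :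
    ∃ Γ', IsLiftOn p c y₀ (Icc 0 b) Γ' := by
  classical
  have hglue : q.symm (c a) = Γ a := by
    rw [← h.2.1 a ⟨ha, le_rfl⟩, hq, q.left_inv hqa]
  set Γ' : ℝ → Y := fun σ => if σ ≤ a then Γ σ else q.symm (c σ)
  have h1 : EqOn Γ' Γ (Icc 0 a) := fun σ hσ => if_pos hσ.2
  have h2 : EqOn Γ' (fun σ => q.symm (c σ)) (Icc a b) := by
    intro σ hσ
    rcases hσ.1.eq_or_lt with rfl | hlt
    · exact (if_pos le_rfl).trans hglue.symm
    · exact if_neg (not_le.2 hlt)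
  have hIcc : Icc 0 b = Icc 0 a ∪ Icc a b := (Icc_union_Icc_eq_Icc ha hab).symm
  refine ⟨Γ', ?_, ?_, ?_⟩
  · rw [hIcc]
    refine ContinuousOn.union_of_isClosed (h.1.congr h1) (ContinuousOn.congr ?_ h2) isClosed_Icc isClosed_Icc
    exact q.continuousOn_symm.comp hc.continuousOn hqc
  · intro σ hσ
    rw [hIcc] at hσ
    rcases hσ with hσ | hσ
    · rw [h1 hσ, h.2.1 σ hσ]
    · rw [h2 hσ, hq]
      exact q.right_inv (hqc σ hσ)
  · rw [h1 ⟨le_rfl, ha⟩, h.2.2]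

/-- A path lifts through a local homeomorphism if its partial lifts do not escape. -/
theorem exists_isLiftOn_Icc [T2Space X] [T2Space Y] (hp : IsLocalHomeomorph p) (hc : Continuous c)
    (h₀ : p y₀ = c 0)
    (hesc : ∀ b : ℝ, 0 < b → ∀ Γ, IsLiftOn p c y₀ (Ico 0 b) Γ → ∃ y, MapClusterPt y (𝓝[<] b) Γ)
    {b : ℝ} (hb : 0 ≤ b) : ∃ Γ, IsLiftOn p c y₀ (Icc 0 b) Γ := by
  classical
  set S : Set ℝ := {a | 0 ≤ a ∧ ∃ Γ, IsLiftOn p c y₀ (Icc 0 a) Γ}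
  have h0S : (0 : ℝ) ∈ S := by
    refine ⟨le_rfl, fun _ => y₀, continuousOn_const, ?_, rfl⟩
    rintro σ ⟨h1, h2⟩
    rw [le_antisymm h2 h1, h₀]
  by_contra hcon
  have hdown : ∀ a ∈ S, ∀ a', 0 ≤ a' → a' ≤ a → a' ∈ S := fun a ⟨_, Γ, hΓ⟩ a' h1 h2 =>
    ⟨h1, Γ, hΓ.mono (Icc_subset_Icc_right h2)⟩
  have hbdd : ∀ a ∈ S, a ≤ b := fun a ha => by
    by_contra hlt
    exact hcon (hdown a ha b hb (not_le.1 hlt).le).2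
  set β := sSup S
  have hβ : ∀ a ∈ S, a ≤ β := fun a ha => le_csSup ⟨b, hbdd⟩ ha
  have hltS : ∀ a, 0 ≤ a → a < β → a ∈ S := fun a h1 h2 => by
    obtain ⟨a', ha', hlt⟩ := exists_lt_of_lt_csSup ⟨0, h0S⟩ h2
    exact hdown a' ha' a h1 hlt.le
  have hβ0 : 0 ≤ β := hβ 0 h0S
  have target_near : ∀ (q : OpenPartialHomeomorph Y X), c β ∈ q.target →
      ∃ η > 0, ∀ σ, |σ - β| < η → c σ ∈ q.target := fun q hq => by
    obtain ⟨η, hη, h⟩ :=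
      Metric.eventually_nhds_iff.1 (hc.continuousAt.eventually (q.open_target.mem_nhds hq))
    exact ⟨η, hη, fun σ hσ => h (by rwa [Real.dist_eq])⟩
  by_cases hβS : β ∈ S
  · obtain ⟨-, Γ, hΓ⟩ := hβS
    obtain ⟨q, hyq, hq⟩ := hp (Γ β)
    have hcβ : c β ∈ q.target := by
      rw [← hΓ.2.1 β ⟨hβ0, le_rfl⟩, hq]
      exact q.map_source hyq
    obtain ⟨η, hη, hηq⟩ := target_near q hcβ
    have := hΓ.extend hc hβ0 (b := β + η / 2) (by linarith) hq hyq fun σ hσ =>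
      hηq σ (by rw [abs_lt]; constructor <;> linarith [hσ.1, hσ.2])
    linarith [hβ (β + η / 2) ⟨by linarith, this⟩]
  have hβpos : 0 < β := hβ0.lt_of_ne fun h => hβS (h ▸ h0S)
  have : Nonempty Y := ⟨y₀⟩
  choose! Γ hΓ using fun a (ha : a ∈ S) => ha.2
  have hcompat : ∀ a ∈ S, ∀ a' ∈ S, a ≤ a' → EqOn (Γ a) (Γ a') (Icc 0 a) := by
    intro a ha a' ha' hle
    refine (T2Space.isSeparatedMap p).eqOn_of_comp_eqOn hp.isLocallyInjective isPreconnected_Icc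
      (hΓ a ha).1 ((hΓ a' ha').1.mono (Icc_subset_Icc_right hle)) ?_ (a := 0) ⟨le_rfl, ha.1⟩ ?_
    · intro σ hσ
      exact ((hΓ a ha).2.1 σ hσ).trans ((hΓ a' ha').2.1 σ (Icc_subset_Icc_right hle hσ)).symm
    · rw [(hΓ a ha).2.2, (hΓ a' ha').2.2]
  -- The midpoint lies in `S` strictly beyond `σ`, so `Λ` agrees on `[0, (σ + β) / 2]` with a single
  -- lift and is continuous at `σ`.
  set Λ : ℝ → Y := fun σ => Γ ((σ + β) / 2) σ
  have hΛ : ∀ a ∈ S, EqOn Λ (Γ a) (Icc 0 a) := by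
    intro a ha σ hσ
    have hσβ : σ < β := lt_of_le_of_ne (hσ.2.trans (hβ a ha)) fun h =>
      hβS (hdown a ha β hβ0 (h ▸ hσ.2))
    have hm : (σ + β) / 2 ∈ S := hltS _ (by linarith [hσ.1]) (by linarith)
    rcases le_total ((σ + β) / 2) a with h | h
    · exact hcompat _ hm _ ha h ⟨hσ.1, by linarith⟩
    · exact (hcompat _ ha _ hm h hσ).symm
  have hlift : IsLiftOn p c y₀ (Ico 0 β) Λ := by
    refine ⟨fun σ hσ => ?_, fun σ hσ => ?_, ?_⟩
    · have hm : (σ + β) / 2 ∈ S := hltS _ (by linarith [hσ.1]) (by linarith [hσ.2])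
      have h1 : ContinuousWithinAt (Γ ((σ + β) / 2)) (Icc 0 ((σ + β) / 2)) σ :=
        (hΓ _ hm).1 σ ⟨hσ.1, by linarith [hσ.2]⟩
      have h2 : ContinuousWithinAt Λ (Icc 0 ((σ + β) / 2)) σ :=
        h1.congr (hΛ _ hm) (hΛ _ hm ⟨hσ.1, by linarith [hσ.2]⟩)
      refine h2.mono_of_mem_nhdsWithin ?_
      filter_upwards [self_mem_nhdsWithin, mem_nhdsWithin_of_mem_nhds
        (Iio_mem_nhds (show σ < (σ + β) / 2 by linarith [hσ.2]))] with τ h3 h4 using ⟨h3.1, le_of_lt h4⟩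
    · have ha := hltS σ hσ.1 hσ.2
      rw [hΛ _ ha ⟨hσ.1, le_rfl⟩, (hΓ _ ha).2.1 σ ⟨hσ.1, le_rfl⟩]
    · rw [hΛ _ h0S ⟨le_rfl, le_rfl⟩, (hΓ _ h0S).2.2]
  obtain ⟨y, hy⟩ := hesc β hβpos Λ hlift
  have hpy : p y = c β := by
    have h1 : MapClusterPt (p y) (𝓝[<] β) (p ∘ Λ) := hy.continuousAt_comp hp.continuous.continuousAt
    have h2 : Tendsto (p ∘ Λ) (𝓝[<] β) (𝓝 (c β)) := by
      refine ((hc.tendsto β).mono_left nhdsWithin_le_nhds).congr' ?_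
      filter_upwards [Ioo_mem_nhdsLT hβpos] with σ hσ using (hlift.2.1 σ ⟨hσ.1.le, hσ.2⟩).symm
    exact eq_of_nhds_neBot (h1.clusterPt.mono h2)
  obtain ⟨q, hyq, hq⟩ := hp y
  have hcβ : c β ∈ q.target := by
    rw [← hpy, hq]
    exact q.map_source hyq
  obtain ⟨η, hη, hηq⟩ := target_near q hcβ
  -- A cluster point suffices: at some time `a` close to `β` the lift is in the domain of the local
  -- inverse at `y`, which carries it past `β`.
  have hfreq : ∃ᶠ σ in 𝓝[<] β, Λ σ ∈ q.source := hy.frequently (q.open_source.mem_nhds hyq)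
  have hev : ∀ᶠ σ in 𝓝[<] β, σ ∈ Ioo (max 0 (β - η)) β :=
    Ioo_mem_nhdsLT (max_lt hβpos (by linarith))
  obtain ⟨a, haq, ha1, ha2⟩ := (hfreq.and_eventually hev).exists
  have ha0 : 0 ≤ a := (le_max_left _ _).trans ha1.le
  have haη : β - η < a := (le_max_right _ _).trans_lt ha1
  have := (hlift.mono (s := Icc 0 a) fun σ hσ => ⟨hσ.1, hσ.2.trans_lt ha2⟩).extend hc ha0
    (b := β + η / 2) (by linarith) hq haq fun σ hσ =>
      hηq σ (by rw [abs_lt]; constructor <;> linarith [hσ.1, hσ.2])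
  linarith [hβ (β + η / 2) ⟨by linarith, this⟩]

/-- If a path avoids the asymptotic values of `f : W → X`, its partial lifts do not escape. -/
theorem exists_mapClusterPt_of_not_asymptotic [T2Space X] [CompactSpace X] {f : X → X} {W W' : Set X}
    (hW : IsOpen W) (hf : ContinuousOn f W) (hW'W : W' ⊆ W) (hc : Continuous c) {b : ℝ} (hb : 0 < b)
    (hW' : ∀ w ∈ W, f w = c b → w ∈ W') (hasym : ¬ IsAsymptoticValue f W (c b)) {y₀ : W'}
    {Γ : ℝ → W'} (hΓ : IsLiftOn (fun w : W' => f w) c y₀ (Ico 0 b) Γ) :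
    ∃ y, MapClusterPt y (𝓝[<] b) Γ := by
  by_contra hno
  push Not at hno
  have htend : Tendsto (fun σ => f (Γ σ)) (𝓝[<] b) (𝓝 (c b)) := by
    refine ((hc.tendsto b).mono_left nhdsWithin_le_nhds).congr' ?_
    filter_upwards [Ioo_mem_nhdsLT hb] with σ hσ using (hΓ.2.1 σ ⟨hσ.1.le, hσ.2⟩).symm
  -- By compactness it is enough to locate cluster points in the closure of `W`. One inside `W`
  -- would lie over `c b`, hence in `W'`, and would be a cluster point of the lift, which was
  -- excluded.
  have hfront : Tendsto (fun σ => (Γ σ : X)) (𝓝[<] b) (𝓝ˢ (frontier W)) := by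
    refine IsCompact.tendsto_nhdsSet_of_mapClusterPt (isClosed_closure (s := W)).isCompact
      (Eventually.of_forall fun σ => subset_closure (hW'W (Γ σ).2)) fun w hw hcl => ?_
    rw [hW.frontier_eq]
    refine ⟨hw, fun hwW => ?_⟩
    have hfw : f w = c b := by
      have h1 : MapClusterPt (f w) (𝓝[<] b) (f ∘ fun σ => (Γ σ : X)) :=
        hcl.continuousAt_comp (hf.continuousAt (hW.mem_nhds hwW))
      exact eq_of_nhds_neBot (h1.clusterPt.mono htend)
    refine hno ⟨w, hW' w hwW hfw⟩ (mapClusterPt_iff_frequently.2 fun s hs => ?_)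
    rw [nhds_subtype_eq_comap] at hs
    obtain ⟨t, ht, hts⟩ := hs
    exact (mapClusterPt_iff_frequently.1 hcl t ht).mono fun σ hσ => hts hσ
  -- The substitution `b t / (1 + t)` turns the lift on `[0, b)` into a curve on `[0, ∞)`.
  refine hasym ⟨fun t => Γ (b * (t / (1 + t))), ?_, fun t => hW'W (Γ _).2, ?_, ?_⟩
  · refine continuous_subtype_val.comp (hΓ.1.comp_continuous ?_ fun t => ?_)
    · have : ∀ t : ℝ≥0, (1 + (t : ℝ)) ≠ 0 := fun t => by positivity
      fun_prop (disch := exact this _)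
    · refine ⟨by positivity, ?_⟩
      have : (t : ℝ) / (1 + t) < 1 := by rw [div_lt_one (by positivity)]; linarith
      nlinarith
  all_goals
    have hparam : Tendsto (fun t : ℝ≥0 => b * ((t : ℝ) / (1 + t))) atTop (𝓝[<] b) := by
      refine tendsto_nhdsWithin_iff.2 ⟨?_, Eventually.of_forall fun t => ?_⟩
      · have h1 : Tendsto (fun t : ℝ≥0 => (1 + (t : ℝ))⁻¹) atTop (𝓝 0) :=
          (tendsto_atTop_add_const_left atTop 1 (NNReal.tendsto_coe_atTop.2 tendsto_id)).inv_tendsto_atTop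
        have h2 : Tendsto (fun t : ℝ≥0 => b * (1 - (1 + (t : ℝ))⁻¹)) atTop (𝓝 (b * (1 - 0))) :=
          (h1.const_sub 1).const_mul b
        rw [sub_zero, mul_one] at h2
        refine h2.congr fun t => ?_
        have : (1 + (t : ℝ)) ≠ 0 := by positivity
        field_simp
        ring
      · have : (t : ℝ) / (1 + t) < 1 := by rw [div_lt_one (by positivity)]; linarith
        rw [mem_Iio]
        nlinarith
  · exact hfront.comp hparam
  · exact htend.comp hparam

/-- A continuous map from a simply connected space that avoids the asymptotic values of
`f : W → X`, and whose preimages lie in a set `W'` where `f` is a local homeomorphism, lifts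
through `f`. -/
theorem exists_lift_of_not_asymptotic [T2Space X] [CompactSpace X] {f : X → X} {W W' : Set X}
    (hW : IsOpen W) (hf : ContinuousOn f W) (hW'W : W' ⊆ W)
    (hloc : IsLocalHomeomorph fun w : W' => f w)
    {T : Type*} [TopologicalSpace T] [SimplyConnectedSpace T] [LocallyPathConnectedSpace T]
    (u : C(T, X)) (hW' : ∀ t, ∀ w ∈ W, f w = u t → w ∈ W')
    (hasym : ∀ t, ¬ IsAsymptoticValue f W (u t)) {t₁ : T} {w₁ : X} (hw₁ : w₁ ∈ W)
    (hfw₁ : f w₁ = u t₁) :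
    ∃ α : C(T, X), α t₁ = w₁ ∧ ∀ t, α t ∈ W ∧ f (α t) = u t := by
  set p : W' → X := fun w => f w
  set e₀ : W' := ⟨w₁, hW' t₁ w₁ hw₁ hfw₁⟩
  have hsep : IsSeparatedMap p := T2Space.isSeparatedMap p
  have ex : ∀ γ : C(unitInterval, T), γ 0 = t₁ → ∃ Γ : C(unitInterval, W'), Γ 0 = e₀ ∧ p ∘ Γ = u.comp γ := by
    intro γ hγ
    let c : ℝ → X := fun σ => u (γ (projIcc 0 1 zero_le_one σ))
    have hc_def : ∀ σ, c σ = u (γ (projIcc 0 1 zero_le_one σ)) := fun σ => rfl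
    have hc : Continuous c := u.continuous.comp (γ.continuous.comp continuous_projIcc)
    obtain ⟨Γ, hΓ⟩ := exists_isLiftOn_Icc (p := p) (c := c) (y₀ := e₀) hloc hc
      (by
        have : projIcc (0 : ℝ) 1 zero_le_one 0 = 0 := projIcc_left _
        rw [hc_def, this, hγ]
        exact hfw₁)
      (fun b hb Γ hΓ => exists_mapClusterPt_of_not_asymptotic hW hf hW'W hc hb
        (fun w hw h => hW' (γ (projIcc 0 1 zero_le_one b)) w hw h)
        (hasym (γ (projIcc 0 1 zero_le_one b))) hΓ) zero_le_one
    refine ⟨⟨fun σ => Γ σ, hΓ.1.comp_continuous continuous_subtype_val fun σ => σ.2⟩, ?_, ?_⟩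
    · simpa using hΓ.2.2
    · ext σ
      have := hΓ.2.1 σ σ.2
      simpa [hc_def] using this
  have luniq : ∀ Γ Γ' : C(unitInterval, W'), Γ 0 = Γ' 0 → p ∘ Γ = p ∘ Γ' → Γ = Γ' := fun Γ Γ' h0 h =>
    DFunLike.coe_injective (hsep.eq_of_comp_eq hloc.isLocallyInjective Γ.continuous Γ'.continuous h 0 h0)
  -- Monodromy: two paths with common endpoints are homotopic in `T`, and every path of the homotopy
  -- lifts, so the lifted endpoints agree.
  have huniq : ∀ γ γ' : C(unitInterval, T), ∀ Γ Γ' : C(unitInterval, W'), γ 0 = t₁ → γ' 0 = t₁ →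
      Γ 0 = e₀ → Γ' 0 = e₀ → p ∘ Γ = u.comp γ → p ∘ Γ' = u.comp γ' → γ 1 = γ' 1 → Γ 1 = Γ' 1 := by
    intro γ γ' Γ Γ' hγ hγ' hΓ hΓ' hl hl' h1
    let P : Path t₁ (γ 1) := ⟨γ, hγ, rfl⟩
    let P' : Path t₁ (γ 1) := ⟨γ', hγ', h1.symm⟩
    obtain ⟨G⟩ := SimplyConnectedSpace.paths_homotopic P P'
    have hG0 : ∀ t, (G.eval t).toContinuousMap 0 = t₁ := fun t => (G.eval t).source
    choose Δ hΔ0 hΔ using fun t => ex (G.eval t).toContinuousMap (hG0 t)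
    have hmono := hloc.monodromy_theorem hsep
      (ContinuousMap.HomotopyRel.compContinuousMap G u) Δ
      (fun t s => congr_fun (hΔ t) s) (fun t => by rw [hΔ0, hΔ0]) 1
    have e0 : Δ 0 = Γ := luniq _ _ (by rw [hΔ0, hΓ]) (by
      rw [hΔ, hl]; ext s; simp [P])
    have e1 : Δ 1 = Γ' := luniq _ _ (by rw [hΔ0, hΓ']) (by
      rw [hΔ, hl']; ext s; simp [P'])
    rw [← e0, ← e1, hmono]
  obtain ⟨F, ⟨hF₀, hF⟩, -⟩ := hloc.existsUnique_continuousMap_lifts u t₁ e₀ hfw₁ ex huniq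
  refine ⟨⟨fun t => F t, continuous_subtype_val.comp F.continuous⟩, by simp [hF₀, e₀], fun t => ?_⟩
  exact ⟨hW'W (F t).2, congr_fun hF t⟩

end PathLifting

/-! ### Injective holomorphic maps have no critical points -/

section InjectiveHolomorphic

/-- Zeros of `g'` are isolated, so the local inverse is holomorphic off `g z₀`. It is continuous at
`g z₀`, hence holomorphic there by removability, and the chain rule for `h ∘ g = id` excludes `g' z₀
= 0`. -/
theorem deriv_ne_zero_of_injOn {g : ℂ → ℂ} {z₀ : ℂ} (hg : AnalyticAt ℂ g z₀) {B : Set ℂ}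
    (hB : B ∈ 𝓝 z₀) (hinj : InjOn g B) : deriv g z₀ ≠ 0 := by
  have hnc : ¬ ∀ᶠ z in 𝓝 z₀, g z = g z₀ := not_eventually_eq_of_locInjAt ⟨B, hB, hinj⟩
  have hd : ∀ᶠ z in 𝓝[≠] z₀, deriv g z ≠ 0 := by
    refine hg.deriv.eventually_eq_zero_or_eventually_ne_zero.resolve_left fun h => hnc ?_
    obtain ⟨r, hr, hr'⟩ := Metric.eventually_nhds_iff_ball.1
      (h.and (Complex.analyticAt_iff_eventually_differentiableAt.1 hg))
    filter_upwards [Metric.ball_mem_nhds z₀ hr] with z hz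
    refine (convex_ball z₀ r).is_const_of_fderivWithin_eq_zero (𝕜 := ℂ)
      (fun w hw => (hr' w hw).2.differentiableWithinAt) (fun w hw => ?_) hz (Metric.mem_ball_self hr)
    rw [fderivWithin_of_isOpen Metric.isOpen_ball hw]
    exact ContinuousLinearMap.ext_ring (by simpa using (hr' w hw).1)
  rw [eventually_nhdsWithin_iff] at hd
  obtain ⟨r, hr, hr'⟩ := Metric.eventually_nhds_iff_ball.1 ((hd.and hB).and hg.eventually_analyticAt)
  set S := Metric.ball z₀ r
  have hSinj : InjOn g S := hinj.mono fun z hz => (hr' z hz).1.2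
  set h := Function.invFunOn g S
  have hleft : ∀ z ∈ S, h (g z) = z := fun z hz => hSinj.leftInvOn_invFunOn hz
  have hleft' : ∀ z ∈ S, ∀ᶠ x in 𝓝 z, h (g x) = x := fun z hz => by
    filter_upwards [Metric.isOpen_ball.mem_nhds hz] with x hx using hleft x hx
  have hopen : 𝓝 (g z₀) ≤ map g (𝓝 z₀) :=
    hg.eventually_constant_or_nhds_le_map_nhds.resolve_left hnc
  have hz₀ : z₀ ∈ S := Metric.mem_ball_self hr
  have hdiff : ∀ᶠ w in 𝓝[≠] g z₀, DifferentiableAt ℂ h w := by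
    rw [eventually_nhdsWithin_iff]
    have : g '' S ∈ 𝓝 (g z₀) :=
      hopen (mem_map.2 (mem_of_superset (Metric.isOpen_ball.mem_nhds hz₀) (subset_preimage_image _ _)))
    filter_upwards [this]
    rintro _ ⟨z, hz, rfl⟩ hne
    have hzne : z ≠ z₀ := fun e => hne (by rw [e]; rfl)
    exact ((hr' z hz).2.hasStrictDerivAt.to_local_left_inverse ((hr' z hz).1.1 hzne)
      (hleft' z hz)).hasDerivAt.differentiableAt
  have hcont : ContinuousAt h (g z₀) := by
    intro N hN
    rw [hleft z₀ hz₀] at hN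
    have : g '' (N ∩ S) ∈ 𝓝 (g z₀) := hopen (mem_map.2 (mem_of_superset
      (inter_mem hN (Metric.isOpen_ball.mem_nhds hz₀)) (subset_preimage_image _ _)))
    rw [mem_map]
    filter_upwards [this]
    rintro _ ⟨z, hz, rfl⟩
    rw [mem_preimage, hleft z hz.2]
    exact hz.1
  have hh := (Complex.analyticAt_of_differentiable_on_punctured_nhds_of_continuousAt hdiff hcont)
  have hcomp : HasDerivAt (fun z => h (g z)) (deriv h (g z₀) * deriv g z₀) z₀ :=
    hh.differentiableAt.hasDerivAt.comp z₀ hg.differentiableAt.hasDerivAt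
  have hid : HasDerivAt (fun z => h (g z)) 1 z₀ := (hasDerivAt_id z₀).congr_of_eventuallyEq
    (hleft' z₀ hz₀)
  intro h0
  have := hcomp.unique hid
  rw [h0, mul_zero] at this
  exact zero_ne_one this

variable {X : Type*} [TopologicalSpace X] [ChartedSpace ℂ X] [IsManifold 𝓘(ℂ) 1 X] {f : X → X}
  {W : Set X}

theorem mfderiv_ne_zero_of_locInjAt (hW : IsOpen W) (hf : MDifferentiableOn 𝓘(ℂ) 𝓘(ℂ) f W) {w : X}
    (hw : w ∈ W) (h : LocInjAt f w) : mfderiv 𝓘(ℂ) 𝓘(ℂ) f w ≠ 0 := by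
  rw [mfderiv_eq_fderiv_chart (hf.mdifferentiableAt (hW.mem_nhds hw))]
  have hn := eventually_mem_chart_source hW hf hw
  have ha := analyticAt_chart hW hf hw
  set c := chartAt ℂ w
  set c' := chartAt ℂ (f w)
  have hws : w ∈ c.source := mem_chart_source ℂ w
  obtain ⟨B, hB, hinj⟩ := h
  have hBc : c.target ∩ c.symm ⁻¹' (B ∩ {v | v ∈ c.source ∧ f v ∈ c'.source}) ∈ 𝓝 (c w) := by
    refine inter_mem (c.open_target.mem_nhds (c.map_source hws)) ?_
    refine (c.continuousAt_symm (c.map_source hws)).preimage_mem_nhds ?_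
    rw [c.left_inv hws]
    exact inter_mem hB hn
  have hd := deriv_ne_zero_of_injOn ha hBc ?_
  · intro h0
    refine hd ?_
    rw [← fderiv_apply_one_eq_deriv]
    exact congrArg (fun L : ℂ →L[ℂ] ℂ => L 1) h0
  · rintro z ⟨hz, hzB, -, hz'⟩ v ⟨hv, hvB, -, hv'⟩ hzv
    exact c.symm.injOn hz hv (hinj hzB hvB (c'.injOn hz' hv' hzv))

end InjectiveHolomorphic

/-! ### Iterates of partially defined maps -/

section Iterates

variable {X : Type*} {f : X → X} {W : Set X}

theorem iterTo_zero {x y : X} : IterTo f W 0 x y ↔ x = y := by simp [IterTo]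

theorem iterTo_succ {n : ℕ} {x y : X} : IterTo f W (n + 1) x y ↔ x ∈ W ∧ IterTo f W n (f x) y := by
  simp only [IterTo, Function.iterate_succ_apply]
  constructor
  · rintro ⟨h, hy⟩
    exact ⟨h 0 n.succ_pos, fun j hj => h (j + 1) (by omega), hy⟩
  · rintro ⟨h0, h, hy⟩
    refine ⟨fun j hj => ?_, hy⟩
    cases j with
    | zero => exact h0
    | succ j => exact h j (by omega)

theorem iterTo_add {m n : ℕ} {x z : X} :
    IterTo f W (m + n) x z ↔ IterTo f W m x (f^[m] x) ∧ IterTo f W n (f^[m] x) z := by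
  induction m generalizing x with
  | zero => simp [iterTo_zero]
  | succ m ih => rw [Nat.add_right_comm, iterTo_succ, iterTo_succ, ih, Function.iterate_succ_apply,
      and_assoc]

/-- An orbit that has reached a periodic point can continue around the cycle, so preimages of
different orders can be brought to a common order. -/
theorem IterTo.add_mul {m n p : ℕ} {x z : X} (h : IterTo f W m x z) (hz : IterTo f W p z z) :
    IterTo f W (m + n * p) x z := by
  induction n with
  | zero => simpa using h
  | succ n ih =>
    rw [Nat.succ_mul, ← add_assoc, iterTo_add, ih.2]
    exact ⟨ih, hz⟩

end Iterates

/-! ### Persistence, uniqueness and continuation of preimages in a natural family -/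

section NaturalFamily

set_option linter.unusedSectionVars false

variable {E : Type*} [NormedAddCommGroup E] [NormedSpace ℂ E]
  {M : Type*} [TopologicalSpace M] [ChartedSpace E M] [IsManifold 𝓘(ℂ, E) 1 M]
  {X : Type*} [TopologicalSpace X] [T2Space X] [CompactSpace X] [ChartedSpace ℂ X]
  [IsManifold 𝓘(ℂ) 1 X]
  {f : X → X} {W : Set X} {φ ψ : M → X ≃ₜ X}

omit [TopologicalSpace M] [T2Space X] [CompactSpace X] [ChartedSpace ℂ X] [IsManifold 𝓘(ℂ) 1 X] in
theorem mem_famDom {t : M} {x : X} : x ∈ famDom W ψ t ↔ (ψ t).symm x ∈ W := by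
  rw [famDom, Homeomorph.image_eq_preimage_symm, mem_preimage]

omit [TopologicalSpace M] [T2Space X] [CompactSpace X] [ChartedSpace ℂ X] [IsManifold 𝓘(ℂ) 1 X] in
theorem famMap_apply {t : M} {x : X} : famMap f φ ψ t x = φ t (f ((ψ t).symm x)) := rfl

theorem IsHolomorphicQCFamily.continuous_uncurry (h : IsHolomorphicQCFamily E φ) :
    Continuous fun q : M × X => φ q.1 q.2 :=
  continuous_uncurry_of_mdifferentiable h.2

theorem IsHolomorphicQCFamily.continuousAt_symm_apply (h : IsHolomorphicQCFamily E φ) {a : M → X}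
    {s : M} (ha : ContinuousAt a s) : ContinuousAt (fun t => (φ t).symm (a t)) s :=
  ContinuousAt.comp (f := fun t => (t, a t))
    (continuous_uncurry_symm h.continuous_uncurry).continuousAt (continuousAt_id.prodMk ha)

variable (hfam : IsNaturalFamily E f W φ ψ)

include hfam

omit [IsManifold 𝓘(ℂ, E) 1 M] [T2Space X] [CompactSpace X] [IsManifold 𝓘(ℂ) 1 X] in
theorem IsNaturalFamily.isOpen_famDom (t : M) : IsOpen (famDom W ψ t) :=
  (ψ t).isOpenMap _ hfam.isOpen

theorem IsNaturalFamily.isOpen_total : IsOpen {q : M × X | q.2 ∈ famDom W ψ q.1} := by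
  have := hfam.isOpen.preimage (continuous_uncurry_symm hfam.right.continuous_uncurry)
  convert this using 1
  ext q
  exact mem_famDom

theorem IsNaturalFamily.continuousAt_uncurry {q : M × X} (hq : q.2 ∈ famDom W ψ q.1) :
    ContinuousAt (fun q : M × X => famMap f φ ψ q.1 q.2) q := by
  have hs : ContinuousAt (fun q : M × X => (ψ q.1).symm q.2) q :=
    (continuous_uncurry_symm hfam.right.continuous_uncurry).continuousAt
  have hf : ContinuousAt f ((ψ q.1).symm q.2) :=
    hfam.holomorphic_base.continuousOn.continuousAt (hfam.isOpen.mem_nhds (mem_famDom.1 hq))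
  have h1 : ContinuousAt (fun q : M × X => (q.1, f ((ψ q.1).symm q.2))) q :=
    continuousAt_fst.prodMk (ContinuousAt.comp (f := fun q : M × X => (ψ q.1).symm q.2) hf hs)
  exact ContinuousAt.comp (f := fun q : M × X => (q.1, f ((ψ q.1).symm q.2)))
    (g := fun q : M × X => φ q.1 q.2) hfam.left.continuous_uncurry.continuousAt h1

theorem IsNaturalFamily.continuousAt_famMap_apply {a : M → X} {s : M} (ha : ContinuousAt a s)
    (hs : a s ∈ famDom W ψ s) : ContinuousAt (fun t => famMap f φ ψ t (a t)) s :=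
  ContinuousAt.comp (f := fun t => (t, a t)) (g := fun q : M × X => famMap f φ ψ q.1 q.2)
    (hfam.continuousAt_uncurry hs) (continuousAt_id.prodMk ha)

theorem IsNaturalFamily.continuousAt_iterate_apply {a : M → X} {s : M} (ha : ContinuousAt a s) {n : ℕ}
    {z : X} (hs : IterTo (famMap f φ ψ s) (famDom W ψ s) n (a s) z) :
    ContinuousAt (fun t => (famMap f φ ψ t)^[n] (a t)) s := by
  induction n generalizing a with
  | zero => simpa using ha
  | succ n ih =>
    obtain ⟨h1, h2⟩ := iterTo_succ.1 hs
    exact ih (hfam.continuousAt_famMap_apply ha h1) h2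

omit [IsManifold 𝓘(ℂ, E) 1 M] [T2Space X] [CompactSpace X] in
/-- Critical points of the maps of a natural family correspond to each other. -/
theorem IsNaturalFamily.mfderiv_famMap_ne_zero_iff {t : M} {w : X} (hw : w ∈ W) :
    mfderiv 𝓘(ℂ) 𝓘(ℂ) (famMap f φ ψ t) (ψ t w) ≠ 0 ↔ LocInjAt f w := by
  have hD := hfam.isOpen_famDom t
  have hwD : ψ t w ∈ famDom W ψ t := mem_image_of_mem _ hw
  constructor
  · intro h
    obtain ⟨B, hB, hinj⟩ := locInjAt_of_mfderiv_ne_zero hD (hfam.holomorphic t) hwD h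
    refine ⟨_, (ψ t).continuous.continuousAt.preimage_mem_nhds hB, fun v hv v' hv' hvv => ?_⟩
    exact (ψ t).injective (hinj hv hv' (by simp [famMap, hvv]))
  · rintro ⟨B, hB, hinj⟩
    refine mfderiv_ne_zero_of_locInjAt hD (hfam.holomorphic t) hwD ⟨(ψ t).symm ⁻¹' B, ?_, ?_⟩
    · refine (ψ t).symm.continuous.continuousAt.preimage_mem_nhds ?_
      rwa [Homeomorph.symm_apply_apply]
    · intro v hv v' hv' hvv
      exact (ψ t).symm.injective (hinj hv hv' ((φ t).injective hvv))

/-- `e` is a singular value of the base map `f : W → X`, described topologically. -/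
def IsSingularValue (f : X → X) (W : Set X) (e : X) : Prop :=
  (∃ w ∈ W, f w = e ∧ ¬ LocInjAt f w) ∨ IsAsymptoticValue f W e

omit [IsManifold 𝓘(ℂ, E) 1 M] [T2Space X] [CompactSpace X] in
-- Failure of local injectivity and escaping curves are topological, so the homeomorphisms `ψ t` and
-- `φ t` carry them from `f` to every `f_t`.
theorem IsNaturalFamily.singular_famMap {e : X} (he : IsSingularValue f W e) (t : M) :
    IsCriticalValue (famMap f φ ψ t) (famDom W ψ t) (φ t e) ∨
      IsAsymptoticValue (famMap f φ ψ t) (famDom W ψ t) (φ t e) := by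
  rcases he with ⟨w, hw, rfl, hnl⟩ | ⟨γ, hγ, hγW, hγf, hγv⟩
  · left
    refine ⟨ψ t w, mem_image_of_mem _ hw, ?_, by simp [famMap]⟩
    by_contra h
    exact hnl ((hfam.mfderiv_famMap_ne_zero_iff hw).1 h)
  · right
    refine ⟨fun r => ψ t (γ r), (ψ t).continuous.comp hγ, fun r => mem_image_of_mem _ (hγW r), ?_, ?_⟩
    · rw [famDom, ← (ψ t).image_frontier]
      exact ((ψ t).continuous.tendsto_nhdsSet (mapsTo_image _ _)).comp hγf
    · simp only [famMap, Homeomorph.symm_apply_apply]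
      exact ((φ t).continuous.tendsto e).comp hγv

variable {U : Set M} {ζ : M → X} (hmis : ∀ t ∈ U, ¬ HasNonpersistentMisiurewicz f W φ ψ ζ t)
  (hisland : ∀ t, IsAhlforsIslandMap (famMap f φ ψ t) (famDom W ψ t))

omit [IsManifold 𝓘(ℂ, E) 1 M] [CompactSpace X] in
include hisland in
theorem IsNaturalFamily.eventually_ne_base (t : M) {w : X} (hw : w ∈ W) :
    ∀ᶠ v in 𝓝[≠] w, f v ≠ f w := by
  refine eventually_ne_of_nonconstant hfam.isOpen hfam.holomorphic_base (fun x hx => ?_) hw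
  obtain ⟨y, hy, hne⟩ := (hisland t).nonconstant (ψ t x) (mem_image_of_mem _ hx)
  rw [famDom, ← (ψ t).image_connectedComponentIn hx] at hy
  obtain ⟨v, hv, rfl⟩ := hy
  exact ⟨v, hv, fun h => hne (by simp [famMap, h])⟩

include hmis

/-- A solution of `f_t^n(y(t)) = ζ(t)` that meets a singular value moves with it, provided that such
solutions are unique. -/
theorem IsNaturalFamily.eventually_eq_singular {n : ℕ} {s : M} (hs : s ∈ U)
    (uniq : ∀ a b : M → X, ContinuousAt a s → ContinuousAt b s → a s = b s →
      (∀ᶠ t in 𝓝 s, IterTo (famMap f φ ψ t) (famDom W ψ t) n (a t) (ζ t)) →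
      (∀ᶠ t in 𝓝 s, IterTo (famMap f φ ψ t) (famDom W ψ t) n (b t) (ζ t)) → ∀ᶠ t in 𝓝 s, a t = b t)
    {y : M → X} (hy : ContinuousAt y s)
    (hyn : ∀ᶠ t in 𝓝 s, IterTo (famMap f φ ψ t) (famDom W ψ t) n (y t) (ζ t))
    {e : X} (he : IsSingularValue f W e) (hye : y s = φ s e) : ∀ᶠ t in 𝓝 s, y t = φ t e := by
  refine uniq y (fun t => φ t e) hy (hfam.left.2 e s).continuousAt hye hyn ?_
  -- Applied to `v = φ_s(e)`, persistence concerns `φ_t(φ_s⁻¹(v)) = φ_t(e)`: this is the second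
  -- solution needed for `uniq`.
  have := hmis s hs
  simp only [HasNonpersistentMisiurewicz, not_exists, not_and, not_not] at this
  simpa using this n (φ s e) (hfam.singular_famMap he s) (hye ▸ hyn.self_of_nhds)

include hisland

/-- Inductively the images `f_t(a(t))` and `f_t(b(t))` agree. In base coordinates both branches tend
to `w`. If `f` is injective near `w`, they coincide. Otherwise `f w` is singular and persistence
pins both images to `φ_t(f w)`; since the fibre of `f` is isolated at `w`, both branches equal
`ψ_t(w)`. -/
theorem IsNaturalFamily.eventually_eq_of_iterTo (n : ℕ) {s : M} (hs : s ∈ U) :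
    ∀ a b : M → X, ContinuousAt a s → ContinuousAt b s → a s = b s →
      (∀ᶠ t in 𝓝 s, IterTo (famMap f φ ψ t) (famDom W ψ t) n (a t) (ζ t)) →
      (∀ᶠ t in 𝓝 s, IterTo (famMap f φ ψ t) (famDom W ψ t) n (b t) (ζ t)) →
      ∀ᶠ t in 𝓝 s, a t = b t := by
  induction n with
  | zero =>
    intro a b _ _ _ ha hb
    filter_upwards [ha, hb] with t h1 h2
    rw [iterTo_zero.1 h1, iterTo_zero.1 h2]
  | succ n ih =>
    intro a b hac hbc hab ha hb
    simp only [iterTo_succ] at ha hb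
    have haD := ha.self_of_nhds.1
    have hbD := hb.self_of_nhds.1
    have ha'c := hfam.continuousAt_famMap_apply hac haD
    have hb'c := hfam.continuousAt_famMap_apply hbc hbD
    have hab' := ih _ _ ha'c hb'c (by rw [hab]) (ha.mono fun t h => h.2) (hb.mono fun t h => h.2)
    have hα := hfam.right.continuousAt_symm_apply hac
    have hβ := hfam.right.continuousAt_symm_apply hbc
    set w := (ψ s).symm (a s) with hw
    have hwW : w ∈ W := mem_famDom.1 haD
    have hα' : Tendsto (fun t => (ψ t).symm (a t)) (𝓝 s) (𝓝 w) := hα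
    have hβ' : Tendsto (fun t => (ψ t).symm (b t)) (𝓝 s) (𝓝 w) := by
      rw [hw, hab]; exact hβ
    suffices ∀ᶠ t in 𝓝 s, (ψ t).symm (a t) = (ψ t).symm (b t) from
      this.mono fun t h => (ψ t).symm.injective h
    by_cases hloc : LocInjAt f w
    · obtain ⟨B, hB, hinj⟩ := hloc
      filter_upwards [hα'.eventually hB, hβ'.eventually hB, hab'] with t h1 h2 h3
      exact hinj h1 h2 ((φ t).injective h3)
    · have hper := hfam.eventually_eq_singular hmis hs ih ha'c (ha.mono fun t h => h.2)
        (e := f w) (Or.inl ⟨w, hwW, rfl, hloc⟩) rfl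
      have hiso := eventually_nhdsWithin_iff.1 (hfam.eventually_ne_base hisland s hwW)
      filter_upwards [hper, hab', hα'.eventually hiso, hβ'.eventually hiso] with t h1 h2 h3 h4
      have e1 : f ((ψ t).symm (a t)) = f w := (φ t).injective h1
      have e2 : f ((ψ t).symm (b t)) = f w := (φ t).injective (h2.symm.trans h1)
      have e3 : (ψ t).symm (a t) = w := by
        by_contra h
        exact h3 h e1
      have e4 : (ψ t).symm (b t) = w := by
        by_contra h
        exact h4 h e2
      rw [e3, e4]

variable (hU : IsOpen U)
include hU

/-- Two continuous solutions of `f_t^n(y(t)) = ζ(t)` on a connected set agree if they agree at a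
point. -/
theorem IsNaturalFamily.eqOn_of_iterTo (hUc : IsPreconnected U) {n : ℕ} {a b : M → X}
    (hac : ContinuousOn a U) (hbc : ContinuousOn b U)
    (ha : ∀ t ∈ U, IterTo (famMap f φ ψ t) (famDom W ψ t) n (a t) (ζ t))
    (hb : ∀ t ∈ U, IterTo (famMap f φ ψ t) (famDom W ψ t) n (b t) (ζ t))
    {s : M} (hs : s ∈ U) (hab : a s = b s) : EqOn a b U := by
  have hsub := hUc.subset_left_of_subset_union (u := {t | t ∈ U ∧ a t = b t})
    (v := {t | t ∈ U ∧ a t ≠ b t}) ?_ ?_ ?_ ?_ ⟨s, hs, hs, hab⟩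
  · exact fun t ht => (hsub ht).2
  · refine isOpen_iff_mem_nhds.2 ?_
    rintro t ⟨ht, htab⟩
    have hUt := hU.mem_nhds ht
    filter_upwards [hUt, hfam.eventually_eq_of_iterTo hmis hisland n ht a b (hac.continuousAt hUt)
      (hbc.continuousAt hUt) htab (by filter_upwards [hUt] with τ hτ using ha τ hτ)
      (by filter_upwards [hUt] with τ hτ using hb τ hτ)] with τ h1 h2 using ⟨h1, h2⟩
  · refine isOpen_iff_mem_nhds.2 ?_
    rintro t ⟨ht, htab⟩
    have hUt := hU.mem_nhds ht
    filter_upwards [hUt, ((hac.continuousAt hUt).ne_iff_eventually_ne (hbc.continuousAt hUt)).1 htab]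
      with τ h1 h2 using ⟨h1, h2⟩
  · exact Set.disjoint_left.2 fun t h1 h2 => h2.2 h1.2
  · intro t ht
    by_cases h : a t = b t
    · exact Or.inl ⟨ht, h⟩
    · exact Or.inr ⟨ht, h⟩

/-- Every preimage of `ζ(s)` under `f_s^n` can be followed holomorphically over the simply connected
set `U`. -/
theorem IsNaturalFamily.exists_holomorphic_preimage (hUsc : IsSimplyConnected U)
    (hζ : MDifferentiableOn 𝓘(ℂ, E) 𝓘(ℂ) ζ U) (n : ℕ) {s : M} (hs : s ∈ U) {x : X}
    (hx : IterTo (famMap f φ ψ s) (famDom W ψ s) n x (ζ s)) :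
    ∃ y : M → X, MDifferentiableOn 𝓘(ℂ, E) 𝓘(ℂ) y U ∧ y s = x ∧
      ∀ t ∈ U, IterTo (famMap f φ ψ t) (famDom W ψ t) n (y t) (ζ t) := by
  classical
  have hUc : IsPreconnected U := hUsc.isPathConnected.isConnected.isPreconnected
  induction n generalizing x with
  | zero => exact ⟨ζ, hζ, (iterTo_zero.1 hx).symm, fun t _ => iterTo_zero.2 rfl⟩
  | succ n ih =>
    obtain ⟨hxD, hxn⟩ := iterTo_succ.1 hx
    obtain ⟨y', hy', hy's, hy'n⟩ := ih hxn
    have hy'c : ContinuousOn y' U := hy'.continuousOn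
    set w := (ψ s).symm x with hw
    have hwW : w ∈ W := mem_famDom.1 hxD
    have hψw : ψ s w = x := by simp [hw]
    -- A single encounter with a singular value makes `φ_t⁻¹(y'(t))` constant on `U`, and `ψ_t(w)`
    -- is then the required branch. With no encounter, the lifting theorem applies.
    by_cases hsing : ∃ t' ∈ U, ∃ e, IsSingularValue f W e ∧ y' t' = φ t' e
    · obtain ⟨t', ht', e, he, hye⟩ := hsing
      have hall : ∀ t ∈ U, y' t = φ t e := by
        have hec : ContinuousOn (fun t => φ t e) U := fun t _ =>
          (hfam.left.2 e t).continuousAt.continuousWithinAt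
        have hsub := hUc.subset_left_of_subset_union (u := {t | t ∈ U ∧ y' t = φ t e})
          (v := {t | t ∈ U ∧ y' t ≠ φ t e}) ?_ ?_ ?_ ?_ ⟨t', ht', ht', hye⟩
        · exact fun t ht => (hsub ht).2
        · refine isOpen_iff_mem_nhds.2 ?_
          rintro t ⟨ht, hte⟩
          have hUt := hU.mem_nhds ht
          filter_upwards [hUt, hfam.eventually_eq_singular hmis ht
            (hfam.eventually_eq_of_iterTo hmis hisland n ht) (hy'c.continuousAt hUt)
            (by filter_upwards [hUt] with τ hτ using hy'n τ hτ) he hte] with τ h1 h2 using ⟨h1, h2⟩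
        · refine isOpen_iff_mem_nhds.2 ?_
          rintro t ⟨ht, hte⟩
          have hUt := hU.mem_nhds ht
          filter_upwards [hUt, ((hy'c.continuousAt hUt).ne_iff_eventually_ne
            (hec.continuousAt hUt)).1 hte] with τ h1 h2 using ⟨h1, h2⟩
        · exact Set.disjoint_left.2 fun t h1 h2 => h2.2 h1.2
        · intro t ht
          by_cases h : y' t = φ t e
          · exact Or.inl ⟨ht, h⟩
          · exact Or.inr ⟨ht, h⟩
      have hfw : f w = e := by
        apply (φ s).injective
        rw [← hall s hs, hy's]
        rfl
      refine ⟨fun t => ψ t w, (hfam.right.2 w).mdifferentiableOn, hψw, fun t ht => ?_⟩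
      refine iterTo_succ.2 ⟨mem_image_of_mem _ hwW, ?_⟩
      have : famMap f φ ψ t (ψ t w) = y' t := by simp [famMap, hfw, hall t ht]
      rw [this]
      exact hy'n t ht
    · push Not at hsing
      have hnsing : ∀ t ∈ U, ¬ IsSingularValue f W ((φ t).symm (y' t)) := fun t ht h =>
        hsing t ht _ h (by simp)
      have : SimplyConnectedSpace U := hUsc.simplyConnectedSpace
      have : LocallyPathConnectedSpace M := ChartedSpace.locallyPathConnectedSpace E M
      have : LocallyPathConnectedSpace U := hU.locallyPathConnectedSpace
      have hucont : ContinuousOn (fun t => (φ t).symm (y' t)) U := fun t ht =>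
        (hfam.left.continuousAt_symm_apply (hy'c.continuousAt (hU.mem_nhds ht))).continuousWithinAt
      let u : C(U, X) := ⟨fun t => (φ t).symm (y' t), hucont.domRestrict⟩
      obtain ⟨α, hαs, hα⟩ := exists_lift_of_not_asymptotic (W' := {w | w ∈ W ∧ LocInjAt f w})
        hfam.isOpen hfam.holomorphic_base.continuousOn (fun w h => h.1)
        (isLocalHomeomorph_restrict_locInjAt hfam.isOpen hfam.holomorphic_base) u
        (fun t v hv hvu => ⟨hv, by
          by_contra h
          exact hnsing t t.2 (Or.inl ⟨v, hv, hvu, h⟩)⟩)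
        (fun t h => hnsing t t.2 (Or.inr h)) (t₁ := ⟨s, hs⟩) hwW
        (show f w = (φ s).symm (y' s) by rw [hy's]; simp [famMap, hw])
      set y : M → X := fun t => if h : t ∈ U then ψ t (α ⟨t, h⟩) else x with hydef
      have hyU : ∀ t (h : t ∈ U), y t = ψ t (α ⟨t, h⟩) := fun t h => dif_pos h
      have hyD : ∀ t ∈ U, y t ∈ famDom W ψ t := fun t ht => by
        rw [hyU t ht]; exact mem_image_of_mem _ (hα _).1
      have hyF : ∀ t ∈ U, famMap f φ ψ t (y t) = y' t := fun t ht => by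
        rw [hyU t ht, famMap_apply, Homeomorph.symm_apply_apply, (hα _).2]
        exact (φ t).apply_symm_apply _
      have hycont : ContinuousOn y U := by
        rw [continuousOn_iff_continuous_domRestrict]
        have : Continuous fun t : U => ψ t (α t) :=
          hfam.right.continuous_uncurry.comp (continuous_subtype_val.prodMk α.continuous)
        refine this.congr fun t => (hyU t t.2).symm
      refine ⟨y, fun t₁ ht₁ => MDifferentiableAt.mdifferentiableWithinAt ?_, ?_, fun t ht =>
        iterTo_succ.2 ⟨hyD t ht, by rw [hyF t ht]; exact hy'n t ht⟩⟩
      · have hUt := hU.mem_nhds ht₁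
        set v := α ⟨t₁, ht₁⟩
        have hvW : v ∈ W := (hα _).1
        have htot : ∀ᶠ q : M × X in 𝓝 (t₁, y t₁), q.2 ∈ famDom W ψ q.1 :=
          hfam.isOpen_total.mem_nhds (hyD t₁ ht₁)
        -- The comparison branch `t ↦ ψ_t(v)` is holomorphic through the same point, and its image
        -- `φ_t(f v)` is holomorphic too. The derivative is nonzero because `f v` is not singular.
        refine mdifferentiableAt_of_implicit (F := famMap f φ ψ) (x₁ := y t₁) (b := fun t => ψ t v)
          ?_ ?_ ?_ (hycont.continuousAt hUt) (hfam.right.2 v t₁) rfl (hyU t₁ ht₁).symm ?_ ?_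
        · exact htot.mono fun q hq => hfam.continuousAt_uncurry hq
        · exact htot.mono fun q hq =>
            (hfam.holomorphic q.1).mdifferentiableAt ((hfam.isOpen_famDom q.1).mem_nhds hq)
        · rw [hyU t₁ ht₁]
          refine (hfam.mfderiv_famMap_ne_zero_iff hvW).2 ?_
          by_contra h
          exact hnsing t₁ ht₁ (Or.inl ⟨v, hvW, (hα _).2, h⟩)
        · refine (hy'.mdifferentiableAt hUt).congr_of_eventuallyEq ?_
          filter_upwards [hUt] with t ht using hyF t ht
        · refine (hfam.left.2 (f v) t₁).congr_of_eventuallyEq (Eventually.of_forall fun t => ?_)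
          simp [famMap]
      · rw [hyU s hs, hαs, hψw]

end NaturalFamily

end AhlforsIsland

/-! ### Assembling the holomorphic motion -/

theorem proposition3
    {E : Type*} [NormedAddCommGroup E] [NormedSpace ℂ E] [FiniteDimensional ℂ E]
    {M : Type*} [TopologicalSpace M] [T2Space M] [ConnectedSpace M]
    [ChartedSpace E M] [IsManifold 𝓘(ℂ, E) 1 M]
    {X : Type*} [TopologicalSpace X] [T2Space X] [CompactSpace X] [ConnectedSpace X]
    [ChartedSpace ℂ X] [IsManifold 𝓘(ℂ) 1 X]
    (f : X → X) (W : Set X) (φ ψ : M → X ≃ₜ X)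
    (hfam : IsNaturalFamily E f W φ ψ)
    (hisland : ∀ t, IsAhlforsIslandMap (famMap f φ ψ t) (famDom W ψ t))
    (t₀ : M) (p : ℕ) (z₀ : X)
    (hz₀ : IsRepellingPeriodicPoint (famMap f φ ψ t₀) (famDom W ψ t₀) p z₀)
    (U : Set M) (hU : IsOpen U) (ht₀ : t₀ ∈ U) (hUsc : IsSimplyConnected U)
    (ζ : M → X) (hζ : MDifferentiableOn 𝓘(ℂ, E) 𝓘(ℂ) ζ U) (hζ₀ : ζ t₀ = z₀)
    (hrep : ∀ t ∈ U, IsRepellingPeriodicPoint (famMap f φ ψ t) (famDom W ψ t) p (ζ t))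
    (hmis : ∀ t ∈ U, ¬ HasNonpersistentMisiurewicz f W φ ψ ζ t) :
    ∃ H : M → X → X,
      IsHolomorphicMotion E U t₀ (backwardOrbit (famMap f φ ψ t₀) (famDom W ψ t₀) p z₀) H ∧
      (∀ t ∈ U, H t '' backwardOrbit (famMap f φ ψ t₀) (famDom W ψ t₀) p z₀ =
        backwardOrbit (famMap f φ ψ t) (famDom W ψ t) p (ζ t)) ∧
      ∀ t ∈ U, ∀ x ∈ backwardOrbit (famMap f φ ψ t₀) (famDom W ψ t₀) p z₀,
        ∀ y ∈ backwardOrbit (famMap f φ ψ t₀) (famDom W ψ t₀) p z₀,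
          IterTo (famMap f φ ψ t₀) (famDom W ψ t₀) p x y →
            IterTo (famMap f φ ψ t) (famDom W ψ t) p (H t x) (H t y) := by
  subst hζ₀
  have hUc : IsPreconnected U := hUsc.isPathConnected.isConnected.isPreconnected
  have hne : Nonempty (M → X) := ⟨ζ⟩
  have hex : ∀ x ∈ backwardOrbit (famMap f φ ψ t₀) (famDom W ψ t₀) p (ζ t₀), ∃ (y : M → X) (N : ℕ),
      MDifferentiableOn 𝓘(ℂ, E) 𝓘(ℂ) y U ∧ y t₀ = x ∧
        ∀ t ∈ U, IterTo (famMap f φ ψ t) (famDom W ψ t) (N * p) (y t) (ζ t) := by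
    rintro x ⟨N, hN⟩
    obtain ⟨y, h1, h2, h3⟩ :=
      hfam.exists_holomorphic_preimage hmis hisland hU hUsc hζ (N * p) ht₀ hN
    exact ⟨y, N, h1, h2, h3⟩
  choose! y N hy hy₀ hyN using hex
  -- Different points of the backward orbit come with different orders. Raising both by multiples of
  -- the period makes uniqueness applicable to any two branches.
  have raise : ∀ {a : M → X} {n : ℕ} (k : ℕ),
      (∀ t ∈ U, IterTo (famMap f φ ψ t) (famDom W ψ t) (n * p) (a t) (ζ t)) →
      ∀ t ∈ U, IterTo (famMap f φ ψ t) (famDom W ψ t) ((n + k) * p) (a t) (ζ t) := by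
    intro a n k h t ht
    rw [add_mul]
    exact (h t ht).add_mul (hrep t ht).2.1
  have glob : ∀ {a b : M → X} {m n : ℕ}, ContinuousOn a U → ContinuousOn b U →
      (∀ t ∈ U, IterTo (famMap f φ ψ t) (famDom W ψ t) (m * p) (a t) (ζ t)) →
      (∀ t ∈ U, IterTo (famMap f φ ψ t) (famDom W ψ t) (n * p) (b t) (ζ t)) →
      ∀ s ∈ U, a s = b s → EqOn a b U := by
    intro a b m n hac hbc ha hb s hs hab
    refine hfam.eqOn_of_iterTo hmis hisland hU hUc hac hbc (raise n ha) ?_ hs hab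
    rw [add_comm m n]
    exact raise m hb
  refine ⟨fun t x => y x t, ⟨hy, ?_, hy₀⟩, ?_, ?_⟩
  · intro t ht x hx x' hx' hxx
    have := glob (hy x hx).continuousOn (hy x' hx').continuousOn (hyN x hx) (hyN x' hx') t ht hxx ht₀
    rwa [hy₀ x hx, hy₀ x' hx'] at this
  · intro t ht
    apply Subset.antisymm
    · rintro _ ⟨x, hx, rfl⟩
      exact ⟨N x, hyN x hx t ht⟩
    -- Surjectivity: `z` is continued from `t` back to `t₀`, and the branch through the resulting
    -- point is the same one by uniqueness.
    · rintro z ⟨n, hn⟩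
      obtain ⟨b, hb, hbt, hbn⟩ :=
        hfam.exists_holomorphic_preimage hmis hisland hU hUsc hζ (n * p) ht hn
      have hmem : b t₀ ∈ backwardOrbit (famMap f φ ψ t₀) (famDom W ψ t₀) p (ζ t₀) :=
        ⟨n, hbn t₀ ht₀⟩
      refine ⟨b t₀, hmem, ?_⟩
      rw [← hbt]
      exact glob (hy _ hmem).continuousOn hb.continuousOn (hyN _ hmem) hbn t₀ ht₀ (hy₀ _ hmem) ht
  · intro t ht x hx x' hx' hxx
    have hit : ∀ τ ∈ U, IterTo (famMap f φ ψ τ) (famDom W ψ τ) p (y x τ)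
        ((famMap f φ ψ τ)^[p] (y x τ)) ∧
        IterTo (famMap f φ ψ τ) (famDom W ψ τ) (N x * p) ((famMap f φ ψ τ)^[p] (y x τ)) (ζ τ) := by
      intro τ hτ
      -- The extra period ensures that `p` iterations are defined along the branch even when `N x =
      -- 0`.
      have := raise 1 (hyN x hx) τ hτ
      rw [add_comm, add_mul, one_mul] at this
      exact iterTo_add.1 this
    have hcont : ContinuousOn (fun τ => (famMap f φ ψ τ)^[p] (y x τ)) U := fun τ hτ =>
      (hfam.continuousAt_iterate_apply ((hy x hx).continuousOn.continuousAt (hU.mem_nhds hτ))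
        (hit τ hτ).1).continuousWithinAt
    -- The image branch is known only to be continuous, which is all that uniqueness requires; it
    -- agrees with the branch of `x'` at `t₀`.
    have heq := glob hcont (hy x' hx').continuousOn (fun τ hτ => (hit τ hτ).2) (hyN x' hx') t₀ ht₀
      (by rw [hy₀ x hx, hy₀ x' hx']; exact hxx.2) ht
    have := (hit t ht).1
    rwa [show (famMap f φ ψ t)^[p] (y x t) = y x' t from heq] at this
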